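/- For a positive integer $n$ let $[n]=\{1,\dots,n\}$, and let $\log$ denote the logarithm to base $2$. An $r$-graph is a family of $r$-element sets, called edges. For $k\ge 3$, a (loose) $k$-cycle $C_k$ consists of distinct edges $e_1,\dots,e_k$ and distinct vertices $v_1,\dots,v_k$ with $e_i\cap e_{i+1}=\{v_i\}$ for $1\le i\le k-1$, $e_1\cap e_k=\{v_k\}$, and $e_i\cap e_j=\emptyset$ for all other pairs $i\ne j$; a family of edges is $C_k$-free if it contains no $k$-cycle. For $m\ge 2$ and $s\ge 1$, a balanced complete $m$-partite $m$-graph $K_{s:m}$ consists of all $m$-sets meeting each of $m$ pairwise disjoint $s$-element sets in exactly one vertex. An edge-coloring of an $(r-1)$-graph $G$ with $V(G)\subset[n]$ assigns to every edge $e\in G$ a color $z_e\in[n]\setminus e$; its extension is the $r$-graph $G^*=\{e\cup\{z_e\}: e\in G\}$. For $r,k\ge 3$ and $s\ge 1$ let $f_r(n,k,s)$ be the number of edge-colored $(r-1)$-graphs $G=K_{s:r-1}$ (that is, pairs consisting of $G$ and an edge-coloring of $G$) with $V(G)\subset[n]$ whose extension $G^*$ is $C_k$-free. **Theorem.** (i)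 For every even integer $k\ge 4$ there is a constant $D=D_{k/2}>0$, depending only on $k$, such that for all $n,s\ge 1$ $$f_3(n,k,s)\le 2^{(5/2)ks\log n+4s^2\log D}.$$ (ii) For all integers $r>3$ and $k\ge 3$ there is a constant $c_2=c_2(r,k)>0$, depending only on $r$ and $k$, such that for all $n,s\ge 1$ $$f_r(n,k,s)\le 2^{(c_2+2r)s^{r-2}\log n+s^{r-1}(\log(c_2+r)+(r-2)\log s)}.$$ -/

import Mathlib

namespace LooseCycle

/-- `H` contains a loose (linear) `k`-cycle: distinct edges `e 0, …, e (k-1)` and distinct vertices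
`v 0, …, v (k-1)` such that cyclically consecutive edges satisfy `e i ∩ e (i+1) = {v i}` (indices
mod `k`) and any two other distinct edges are disjoint. Used for `k ≥ 3`. -/
def ContainsCycle {V : Type*} [DecidableEq V] (k : ℕ) (H : Finset (Finset V)) : Prop :=
  ∃ (e : Fin k → Finset V) (v : Fin k → V),
    Function.Injective e ∧ Function.Injective v ∧
    (∀ i, e i ∈ H) ∧
    (∀ i, e i ∩ e (finRotate k i) = {v i}) ∧
    (∀ i j, i ≠ j → j ≠ finRotate k i → i ≠ finRotate k j → Disjoint (e i) (e j))

/-- `G` is (the edge set of) a balanced complete `m`-partite `m`-graph `K_{s:m}`: there are pairwise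
disjoint parts `P 0, …, P (m-1)` of size `s` such that the edges are exactly the subsets of their
union that meet each part in exactly one vertex. -/
def IsBalancedCompletePartite {V : Type*} [DecidableEq V] (m s : ℕ) (G : Finset (Finset V)) :
    Prop :=
  ∃ P : Fin m → Finset V,
    (∀ i j, i ≠ j → Disjoint (P i) (P j)) ∧
    (∀ i, (P i).card = s) ∧
    ∀ e : Finset V, e ∈ G ↔ e ⊆ Finset.univ.biUnion P ∧ ∀ i, (e ∩ P i).card = 1

/-- A coloring function of `G`: each edge gets a vertex of the ground set outside that edge. -/
def IsColoring {V : Type*} (G : Finset (Finset V)) (χ : {e // e ∈ G} → V) : Prop :=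
  ∀ e : {e // e ∈ G}, χ e ∉ e.1

/-- The extension `G* = {e ∪ {χ e} : e ∈ G}`. -/
def extension {V : Type*} [DecidableEq V] (G : Finset (Finset V)) (χ : {e // e ∈ G} → V) :
    Finset (Finset V) :=
  Finset.univ.image fun e : {e // e ∈ G} => e.1 ∪ {χ e}

/-- `f_r(n,k,s)`: the number of pairs `(G, χ)` with `G` a copy of `K_{s:r-1}` on vertices of `[n]`
(modelled by `Fin n`) and `χ` an edge-coloring of `G` whose extension contains no `C_k`.
The type being counted is finite. -/
noncomputable def f (r n k s : ℕ) : ℕ :=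
  Nat.card {p : (G : Finset (Finset (Fin n))) × ({e // e ∈ G} → Fin n) //
    IsBalancedCompletePartite (r - 1) s p.1 ∧ IsColoring p.1 p.2 ∧
      ¬ ContainsCycle k (extension p.1 p.2)}

end LooseCycle

namespace LooseCycle
open Finset

/-! Both bounds count in three stages: the graph `G` (`card_balanced_le`), a palette containing all
colours used (`card_le_of_card_image_le`), and the colourings of `G` from that palette. The link
with cycles is that a loose cycle in `G` whose edges get distinct colours, none of them in an edge
of the cycle, extends to a loose cycle of `G*` (`IsLooseCycle.expand`).

For `r > 3` the palette has size `O(s^(r-2))`. Pick one edge for each colour outside `V(G)`. If the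
number of these edges exceeds a suitable constant times the size of their shadow, some subfamily has
all its shadow degrees large, and a loose `k`-cycle is built greedily in it
(`exists_looseCycle_of_shadow`); its colours are distinct. Allowing every edge any palette colour is
then cheap enough.

For `r = 3` and `k = 2p` the palette has at most `2ps` colours (`card_image_le_of_free`): a rainbow
subgraph of minimum degree `p` contains a cycle of length `2` modulo `2p - 2`, which chords of
`K_{s,s}` cut down to a rainbow `2p`-cycle. The trivial count `(2ps)^(s^2)` of colourings is now too
large. What saves the factor `log s` in the exponent is that few edges have a colour that is rare at
both endpoints: at most `sqrt(512 p d s^3)` edges have colour degree at most `d` at each end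
(`card_thin_sq_le`). Hence the logarithm of `s` over the larger colour degree is `O(1)` on average
(`sum_log_le`). There are `2^(O(s^2))` possible tables of colour degrees. A table defines a product
weight of total mass at most `1`, under which each colouring with that table has weight at least
`2^(-O(s^2))`; so each table admits `2^(O(s^2))` colourings (`card_colorings_le`). -/

/-! ### Loose cycles of pairs and their expansion. -/

/-- The edges `e` and the vertices `v` form a loose `k`-cycle. -/
def IsLooseCycle {V : Type*} [DecidableEq V] (k : ℕ) (e : Fin k → Finset V) (v : Fin k → V) :
    Prop :=
  Function.Injective e ∧ Function.Injective v ∧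
    (∀ i, e i ∩ e (finRotate k i) = {v i}) ∧
    (∀ i j, i ≠ j → j ≠ finRotate k i → i ≠ finRotate k j → Disjoint (e i) (e j))

lemma IsLooseCycle.containsCycle {V : Type*} [DecidableEq V] {k : ℕ} {e : Fin k → Finset V}
    {v : Fin k → V} (h : IsLooseCycle k e v) {H : Finset (Finset V)} (hH : ∀ i, e i ∈ H) :
    ContainsCycle k H :=
  ⟨e, v, h.1, h.2.1, hH, h.2.2⟩

lemma finRotate_ne_self {k : ℕ} (hk : 2 ≤ k) (i : Fin k) : finRotate k i ≠ i := by
  obtain ⟨n, rfl⟩ : ∃ n, k = n + 1 := ⟨k - 1, by omega⟩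
  intro h
  have := coe_finRotate i
  rw [h] at this
  split_ifs at this with h1
  · subst h1; simp at this; omega
  · omega

/-- Adding a new private vertex to each edge of a loose cycle gives a loose cycle. -/
lemma IsLooseCycle.expand {V : Type*} [DecidableEq V] {k : ℕ} (hk : 2 ≤ k) {e : Fin k → Finset V}
    {v : Fin k → V} (h : IsLooseCycle k e v) {x : Fin k → V} (hx : Function.Injective x)
    (hxe : ∀ i j, x i ∉ e j) : IsLooseCycle k (fun i => insert (x i) (e i)) v := by
  obtain ⟨h1, h2, h3, h4⟩ := h
  have key : ∀ i j, i ≠ j → insert (x i) (e i) ∩ insert (x j) (e j) = e i ∩ e j := by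
    intro i j hij
    have hxy := fun h => hij (@hx i j h)
    ext a
    simp only [mem_inter, mem_insert]
    constructor
    · rintro ⟨rfl | ha, hb | hb⟩
      · exact absurd hb hxy
      · exact absurd hb (hxe _ _)
      · subst hb; exact absurd ha (hxe _ _)
      · exact ⟨ha, hb⟩
    · rintro ⟨ha, hb⟩; exact ⟨Or.inr ha, Or.inr hb⟩
  refine ⟨?_, h2, ?_, ?_⟩
  · intro i j hij
    by_contra hne
    have : x i ∈ insert (x j) (e j) := by
      have hij : insert (x i) (e i) = insert (x j) (e j) := hij
      rw [← hij]; exact mem_insert_self _ _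
    rcases mem_insert.1 this with h | h
    · exact hne (hx h)
    · exact hxe _ _ h
  · intro i
    rw [key _ _ (finRotate_ne_self hk i).symm, h3]
  · intro i j hij hj hi
    rw [disjoint_iff_inter_eq_empty, key i j hij, ← disjoint_iff_inter_eq_empty]
    exact h4 i j hij hj hi

/-- A cyclic sequence of `k ≥ 3` distinct vertices gives a loose cycle of pairs. -/
lemma isLooseCycle_pairs {V : Type*} [DecidableEq V] {k : ℕ} (hk : 3 ≤ k) {w : ℕ → V}
    (hw : Set.InjOn w (Set.Iio k)) (hwk : w k = w 0) :
    IsLooseCycle k (fun i => {w i, w (i + 1)}) (fun i => w (i + 1)) := by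
  -- On indices `0, …, k` the only coincidence is `w 0 = w k`; this reduces every incidence below to
  -- arithmetic.
  have hw' : ∀ a b, a ≤ k → b ≤ k → (w a = w b ↔ a = b ∨ (a = 0 ∧ b = k) ∨ (a = k ∧ b = 0)) := by
    intro a b ha hb
    constructor
    · intro h
      rcases ha.lt_or_eq with ha | rfl <;> rcases hb.lt_or_eq with hb | rfl
      · exact Or.inl (hw ha hb h)
      · rw [hwk] at h
        have := hw ha (show 0 < _ by omega) h
        omega
      · rw [hwk] at h
        have := hw (show 0 < _ by omega) hb h
        omega
      · exact Or.inl rfl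
    · rintro (rfl | ⟨rfl, rfl⟩ | ⟨rfl, rfl⟩)
      · rfl
      · exact hwk.symm
      · exact hwk
  obtain ⟨n, rfl⟩ : ∃ n, k = n + 1 := ⟨k - 1, by omega⟩
  have hrot : ∀ i : Fin (n + 1), ((finRotate (n + 1) i : Fin (n + 1)) : ℕ) =
      (if (i : ℕ) = n then 0 else (i : ℕ) + 1 : ℕ) := by
    intro i
    rw [coe_finRotate]
    simp [Fin.ext_iff]
  refine ⟨?_, ?_, ?_, ?_⟩
  · intro i j hij
    have hi := i.2
    have hj := j.2
    have h1 : w i ∈ ({w j, w (j + 1)} : Finset V) := by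
      have hij : ({w i, w (i + 1)} : Finset V) = {w j, w (j + 1)} := hij
      rw [← hij]; simp
    have h2 : w (i + 1) ∈ ({w j, w (j + 1)} : Finset V) := by
      have hij : ({w i, w (i + 1)} : Finset V) = {w j, w (j + 1)} := hij
      rw [← hij]; simp
    simp only [mem_insert, mem_singleton] at h1 h2
    rw [hw' _ _ (by omega) (by omega), hw' _ _ (by omega) (by omega)] at h1 h2
    ext
    omega
  · intro i j hij
    have hi := i.2
    have hj := j.2
    have := (hw' _ _ (by omega) (by omega)).1 hij
    ext
    omega
  · intro i
    have hi := i.2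
    have hr := hrot i
    set j := finRotate (n + 1) i
    have hj := j.2
    ext a
    simp only [mem_inter, mem_insert, mem_singleton]
    have hij : w (i + 1) = w j := by
      rw [hw' _ _ (by omega) (by omega)]
      split_ifs at hr <;> omega
    constructor
    · rintro ⟨rfl | rfl, h2⟩
      · rw [hw' _ _ (by omega) (by omega), hw' _ _ (by omega) (by omega)] at h2
        split_ifs at hr <;> omega
      · rfl
    · rintro rfl
      exact ⟨Or.inr rfl, Or.inl hij⟩
  · intro i j hij hj hi
    have hi2 := i.2
    have hj2 := j.2
    have hr1 := hrot i
    have hr2 := hrot j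
    rw [Ne, Fin.ext_iff] at hij hj hi
    rw [hr1] at hj
    rw [hr2] at hi
    rw [disjoint_left]
    intro a
    simp only [mem_insert, mem_singleton]
    rintro (rfl | rfl) <;>
    · rw [hw' _ _ (by omega) (by omega), hw' _ _ (by omega) (by omega)]
      split_ifs at hi hj <;> omega

/-! ### Greedy selection and passage to large minimum degree. -/

/-- Greedy choice of distinct values avoiding a finite set. -/
lemma exists_injective_avoiding {V : Type*} [DecidableEq V] (F : Finset V) (N : ℕ) :
    ∀ (k : ℕ) (P : Fin k → V → Prop), F.card + k ≤ N →
      (∀ i, ∀ F' : Finset V, F'.card ≤ N → ∃ x ∉ F', P i x) →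
      ∃ x : Fin k → V, Function.Injective x ∧ (∀ i, x i ∉ F) ∧ ∀ i, P i (x i)
  | 0, _, _, _ => ⟨Fin.elim0, fun i => i.elim0, fun i => i.elim0, fun i => i.elim0⟩
  | k + 1, P, hN, hP => by
    obtain ⟨x, hx, hxF, hxP⟩ := exists_injective_avoiding F N k (fun i => P i.succ) (by omega)
      (fun i => hP i.succ)
    obtain ⟨y, hy, hyP⟩ := hP 0 (F ∪ univ.image x) (by
      refine (card_union_le _ _).trans ?_
      have := card_image_le (s := (univ : Finset (Fin k))) (f := x)
      rw [card_univ, Fintype.card_fin] at this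
      omega)
    simp only [mem_union, mem_image, mem_univ, true_and, not_or, not_exists] at hy
    refine ⟨Fin.cons y x, Fin.cons_injective_iff.2 ⟨?_, hx⟩, ?_, ?_⟩
    · rintro ⟨i, hi⟩; exact hy.2 i hi
    · intro i
      refine Fin.cases ?_ (fun i => ?_) i
      · simpa using hy.1
      · simpa using hxF i
    · intro i
      refine Fin.cases ?_ (fun i => ?_) i
      · simpa using hyP
      · simpa using hxP i

/-- In a finite incidence structure with more than `q * |S|` blocks one can pass to a nonempty
subfamily in which every element of `S` has degree `0` or more than `q`. -/
lemma exists_subset_degree {α β : Type*} [DecidableEq α] [DecidableEq β] (r : α → β → Prop)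
    [∀ a b, Decidable (r a b)] (q : ℕ) : ∀ (n : ℕ) (F : Finset α) (S : Finset β), S.card = n →
      q * S.card < F.card → ∃ F' ⊆ F, F'.Nonempty ∧
        ∀ b ∈ S, ∀ a ∈ F', r a b → q < (F'.filter (fun a => r a b)).card
  | 0, F, S, hn, h => by
    refine ⟨F, Subset.rfl, card_pos.1 (by omega), ?_⟩
    rw [card_eq_zero] at hn
    simp [hn]
  | n + 1, F, S, hn, h => by
    by_cases hS : ∀ b ∈ S, ∀ a ∈ F, r a b → q < (F.filter (fun a => r a b)).card
    · exact ⟨F, Subset.rfl, card_pos.1 (by omega), hS⟩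
    push Not at hS
    obtain ⟨b, hb, a, ha, hab, hq⟩ := hS
    have h1 := card_erase_of_mem hb
    have h2 := card_filter_add_card_filter_not (s := F) (fun a => r a b)
    -- Deleting `b` with its at most `q` blocks preserves `q * |S| < |F|`, and `b` has degree `0` in
    -- every later subfamily.
    obtain ⟨F', hF', hne, hdeg⟩ := exists_subset_degree r q n (F.filter (fun a => ¬ r a b))
      (S.erase b) (by omega) (by
        rw [h1, hn, Nat.add_sub_cancel]
        rw [hn, Nat.mul_succ] at h
        omega)
    refine ⟨F', hF'.trans (filter_subset _ _), hne, ?_⟩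
    intro b' hb' a' ha' hr
    by_cases hbb : b' = b
    · subst hbb
      exact absurd hr (mem_filter.1 (hF' ha')).2
    · exact hdeg b' (mem_erase.2 ⟨hbb, hb'⟩) a' ha' hr

/-! ### Loose cycles in hypergraphs of uniformity at least three. -/

section Extendable
variable {V : Type*} [DecidableEq V] {S : Finset V → Prop} {m d : ℕ}

/-- A down-closed family in which sets of size less than `m` have many one-point extensions contains
all cycles of pairs. -/
lemma exists_cyclic_pairs (hdown : ∀ T, S T → ∀ T' ⊆ T, S T') (hm : 3 ≤ m)
    (hext : ∀ T, S T → T.card < m → ∀ F : Finset V, F.card ≤ d → ∃ x ∉ F, S (insert x T))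
    (h0 : S ∅) (k : ℕ) (hk : 3 ≤ k) (hd : k ≤ d) :
    ∃ w : ℕ → V, Set.InjOn w (Set.Iio k) ∧ w k = w 0 ∧ ∀ i < k, S {w i, w (i + 1)} := by
  induction k, hk using Nat.le_induction with
  | base =>
    obtain ⟨a, -, ha⟩ := hext ∅ h0 (by simp; omega) ∅ (by simp)
    obtain ⟨b, hb, hab⟩ := hext _ ha (by simp; omega) {a} (by simp; omega)
    obtain ⟨c, hc, habc⟩ := hext _ hab ((card_insert_le _ _).trans_lt (by simp; omega)) {a, b}
      ((card_insert_le _ _).trans (by simp; omega))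
    simp only [mem_singleton, mem_insert, not_or] at hb hc
    refine ⟨fun i => if i = 1 then b else if i = 2 then c else a, ?_, by simp, ?_⟩
    · intro i hi j hj
      simp only [Set.mem_Iio] at hi hj
      interval_cases i <;> interval_cases j <;> simp [hb, hc, Ne.symm hb, Ne.symm hc.1,
        Ne.symm hc.2]
    · intro i hi
      apply hdown _ habc
      interval_cases i <;> intro x <;> simp <;> tauto
  | succ k hk ih =>
    obtain ⟨w, hw, hwk, hS⟩ := ih (by omega)
    -- The closing pair `{w (k-1), w 0}` extends to a triple by a new `x`; going through `x`
    -- lengthens the cycle by one. This is where `3 ≤ m` is needed.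
    obtain ⟨x, hx, hxS⟩ := hext _ (hS (k - 1) (by omega))
      ((card_insert_le _ _).trans_lt (by simp; omega)) ((range k).image w)
      (card_image_le.trans (by simp; omega))
    rw [show k - 1 + 1 = k by omega] at hxS
    simp only [mem_image, mem_range, not_exists, not_and] at hx
    refine ⟨fun i => if i < k then w i else if i = k then x else w 0, ?_, ?_, ?_⟩
    · intro i hi j hj hij
      simp only [Set.mem_Iio] at hi hj hij
      split_ifs at hij with h1 h2 h3 h4 h5 h6
      · exact hw h1 h2 hij
      · exact absurd hij (hx i h1)
      · omega
      · exact absurd hij.symm (hx j (by assumption))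
      · omega
      all_goals omega
    · simp; intro h; omega
    · intro i hi
      rcases lt_trichotomy (i + 1) k with h | h | h
      · simp only [h, show i < k by omega, if_true]
        exact hS i (by omega)
      · simp only [h, show i < k by omega, if_true, lt_irrefl, if_false]
        apply hdown _ hxS
        rw [show k - 1 = i by omega]
        intro y; simp; tauto
      · obtain rfl : i = k := by omega
        simp only [lt_irrefl, if_true, if_false, show ¬ (i + 1 < i) by omega,
          show ¬ (i + 1 = i) by omega]
        apply hdown _ hxS
        rw [hwk]
        intro y; simp; tauto

/-- Such a family contains loose cycles with edges of every size from `2` to `m`. -/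
lemma exists_looseCycle_of_extendable (hdown : ∀ T, S T → ∀ T' ⊆ T, S T') (hm : 3 ≤ m)
    (hext : ∀ T, S T → T.card < m → ∀ F : Finset V, F.card ≤ d → ∃ x ∉ F, S (insert x T))
    (h0 : S ∅) {k : ℕ} (hk : 3 ≤ k) (hd : k * m + k ≤ d) (j : ℕ) (hj : 2 ≤ j) (hjm : j ≤ m) :
    ∃ (e : Fin k → Finset V) (v : Fin k → V), IsLooseCycle k e v ∧ ∀ i, S (e i) ∧ (e i).card = j := by
  induction j, hj using Nat.le_induction with
  | base =>
    obtain ⟨w, hw, hwk, hS⟩ := exists_cyclic_pairs hdown hm hext h0 k hk (by omega)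
    refine ⟨_, _, isLooseCycle_pairs hk hw hwk, fun i => ⟨hS i i.2, ?_⟩⟩
    apply card_pair
    intro h
    have hi := i.2
    rcases eq_or_ne ((i : ℕ) + 1) k with h1 | h1
    · rw [h1, hwk] at h
      have := hw (show (i : ℕ) < k from i.2) (show 0 < k by omega) h
      omega
    · have := hw (show (i : ℕ) < k from i.2) (show (i : ℕ) + 1 < k by omega) h
      omega
  | succ j hj ih =>
    obtain ⟨e, v, hev, he⟩ := ih (by omega)
    obtain ⟨x, hx, hxF, hxS⟩ := exists_injective_avoiding (univ.biUnion e) d k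
      (fun i x => S (insert x (e i))) (by
        have h1 : (univ.biUnion e).card ≤ k * j := by
          refine card_biUnion_le.trans ?_
          simp [he]
        have h2 : k * j ≤ k * m := Nat.mul_le_mul_left _ (by omega)
        omega)
      (fun i F' hF' => hext _ (he i).1 (by rw [(he i).2]; omega) F' hF')
    have hxe : ∀ i j, x i ∉ e j := fun i j h => hxF i (mem_biUnion.2 ⟨j, mem_univ _, h⟩)
    refine ⟨_, v, hev.expand (by omega) hx hxe, fun i => ⟨hxS i, ?_⟩⟩
    rw [card_insert_of_notMem (hxe i i), (he i).2]

end Extendable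

/-- An `m`-graph with more than `(k m + k) |S|` edges, where `S` contains its shadow, contains a
loose `k`-cycle. -/
lemma exists_looseCycle_of_shadow {V : Type*} [DecidableEq V] {m k : ℕ} (hm : 3 ≤ m) (hk : 3 ≤ k)
    (H S : Finset (Finset V)) (hH : ∀ e ∈ H, e.card = m)
    (hS : ∀ e ∈ H, ∀ a ∈ e, e.erase a ∈ S) (hcard : (k * m + k) * S.card < H.card) :
    ∃ (e : Fin k → Finset V) (v : Fin k → V), IsLooseCycle k e v ∧ ∀ i, e i ∈ H := by
  obtain ⟨H', hsub, ⟨e0, he0⟩, hdeg⟩ := exists_subset_degree (fun e T : Finset V => T ⊆ e)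
    (k * m + k) S.card H S rfl hcard
  obtain ⟨e, v, hev, he⟩ := exists_looseCycle_of_extendable (S := fun T => ∃ e ∈ H', T ⊆ e)
    (m := m) (d := k * m + k) (fun T ⟨e, he, hT⟩ T' hT' => ⟨e, he, hT'.trans hT⟩) hm (by
      rintro T ⟨e, he, hT⟩ hTm F hF
      have hem := hH e (hsub he)
      -- The shadow set `e.erase a` contains `T` and lies in more than `k * m + k` edges of `H'`,
      -- each adding a different vertex, so one of them adds a vertex outside `F`.
      obtain ⟨a, hae, haT⟩ := exists_mem_notMem_of_card_lt_card (hTm.trans_le hem.ge)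
      have hlt := hdeg (e.erase a) (hS e (hsub he) a hae) e he (erase_subset _ _)
      have hnot : ¬ H'.filter (fun e' => e.erase a ⊆ e') ⊆ F.image (fun x => insert x (e.erase a)) :=
        fun h => by
          have := (card_le_card h).trans card_image_le
          omega
      obtain ⟨e', he', hne⟩ := not_subset.1 hnot
      rw [mem_filter] at he'
      obtain ⟨x, hx⟩ := card_eq_one.1 (show (e' \ e.erase a).card = 1 by
        rw [card_sdiff_of_subset he'.2, card_erase_of_mem hae, hem, hH e' (hsub he'.1)]
        omega)
      have hee : insert x (e.erase a) = e' := by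
        rw [insert_eq, ← hx, sdiff_union_of_subset he'.2]
      refine ⟨x, fun hxF => hne (mem_image.2 ⟨x, hxF, hee⟩), e', he'.1, ?_⟩
      rw [← hee]
      exact insert_subset_insert _ (subset_erase.2 ⟨hT, haT⟩))
    ⟨e0, he0, empty_subset _⟩ hk le_rfl m (by omega) le_rfl
  refine ⟨e, v, hev, fun i => ?_⟩
  obtain ⟨⟨e', he', hsub'⟩, hc⟩ := he i
  rw [eq_of_subset_of_card_le hsub' (by rw [hc, hH e' (hsub he')])]
  exact hsub he'

/-! ### Transversals and shadows of complete multipartite hypergraphs. -/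

section Partite
variable {V : Type*} [DecidableEq V] {m s : ℕ} {G : Finset (Finset V)} {P : Fin m → Finset V}

/-- Edges of a complete multipartite hypergraph are the images of the transversals. -/
lemma mem_iff_exists_transversal (hP : ∀ i j, i ≠ j → Disjoint (P i) (P j))
    (hG : ∀ e : Finset V, e ∈ G ↔ e ⊆ Finset.univ.biUnion P ∧ ∀ i, (e ∩ P i).card = 1)
    (e : Finset V) : e ∈ G ↔ ∃ f : Fin m → V, (∀ i, f i ∈ P i) ∧ univ.image f = e := by
  have huniq : ∀ i j a, a ∈ P i → a ∈ P j → i = j := by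
    intro i j a hi hj
    by_contra h
    exact disjoint_left.1 (hP i j h) hi hj
  rw [hG]
  constructor
  · rintro ⟨hsub, h1⟩
    have h2 : ∀ i, ∃ a, e ∩ P i = {a} := fun i => card_eq_one.1 (h1 i)
    choose f hf using h2
    have hf' : ∀ i, f i ∈ e ∩ P i := fun i => by rw [hf]; simp
    refine ⟨f, fun i => (mem_inter.1 (hf' i)).2, ?_⟩
    ext a
    simp only [mem_image, mem_univ, true_and]
    constructor
    · rintro ⟨i, rfl⟩; exact (mem_inter.1 (hf' i)).1
    · intro ha
      obtain ⟨i, -, hi⟩ := mem_biUnion.1 (hsub ha)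
      have : a ∈ e ∩ P i := mem_inter.2 ⟨ha, hi⟩
      rw [hf, mem_singleton] at this
      exact ⟨i, this.symm⟩
  · rintro ⟨f, hf, rfl⟩
    refine ⟨?_, fun i => card_eq_one.2 ⟨f i, ?_⟩⟩
    · intro a ha
      obtain ⟨i, -, rfl⟩ := mem_image.1 ha
      exact mem_biUnion.2 ⟨i, mem_univ _, hf i⟩
    · ext a
      simp only [mem_inter, mem_image, mem_univ, true_and, mem_singleton]
      constructor
      · rintro ⟨⟨j, rfl⟩, hj⟩
        rw [huniq j i _ (hf j) hj]
      · rintro rfl; exact ⟨⟨i, rfl⟩, hf i⟩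

lemma card_image_transversal (hP : ∀ i j, i ≠ j → Disjoint (P i) (P j)) {f : Fin m → V}
    (hf : ∀ i, f i ∈ P i) : (univ.image f).card = m := by
  rw [card_image_of_injective, card_univ, Fintype.card_fin]
  intro i j hij
  by_contra h
  exact disjoint_left.1 (hP i j h) (hf i) (hij ▸ hf j)

lemma card_le_pow_of_transversal (hs : ∀ i, (P i).card = s)
    (hG : ∀ e ∈ G, ∃ f : Fin m → V, (∀ i, f i ∈ P i) ∧ univ.image f = e) : G.card ≤ s ^ m := by
  have : G ⊆ (Fintype.piFinset P).image (fun f => univ.image f) := by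
    intro e he
    obtain ⟨f, hf, rfl⟩ := hG e he
    exact mem_image_of_mem _ (Fintype.mem_piFinset.2 hf)
  refine (card_le_card this).trans (card_image_le.trans ?_)
  rw [Fintype.card_piFinset]
  simp [hs]

lemma card_parts_le (hs : ∀ i, (P i).card = s) : (univ.biUnion P).card ≤ m * s := by
  refine card_biUnion_le.trans ?_
  simp [hs]

/-- A shadow set misses exactly one part, leaving `q + 1` choices of the part and `s ^ q`
transversals of the others. The factor of order `s` gained over the `s ^ (q + 1)` edges is the gain
in the palette bound. -/
lemma exists_shadow_superset {q : ℕ} {P : Fin (q + 1) → Finset V}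
    (hP : ∀ i j, i ≠ j → Disjoint (P i) (P j)) (hs : ∀ i, (P i).card = s)
    (hG : ∀ e ∈ G, ∃ f : Fin (q + 1) → V, (∀ i, f i ∈ P i) ∧ univ.image f = e) :
    ∃ S : Finset (Finset V), (∀ e ∈ G, ∀ a ∈ e, e.erase a ∈ S) ∧ S.card ≤ (q + 1) * s ^ q := by
  refine ⟨univ.biUnion fun i : Fin (q + 1) =>
    (Fintype.piFinset fun j => P (i.succAbove j)).image (fun f => univ.image f), ?_, ?_⟩
  · intro e he a ha
    obtain ⟨f, hf, rfl⟩ := hG e he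
    obtain ⟨i, -, rfl⟩ := mem_image.1 ha
    refine mem_biUnion.2 ⟨i, mem_univ _, mem_image.2 ⟨fun j => f (i.succAbove j),
      Fintype.mem_piFinset.2 fun j => hf _, ?_⟩⟩
    have hinj : Function.Injective f := by
      intro i j hij
      by_contra h
      exact disjoint_left.1 (hP i j h) (hf i) (hij ▸ hf j)
    ext b
    simp only [mem_image, mem_univ, true_and, mem_erase]
    constructor
    · rintro ⟨j, rfl⟩
      exact ⟨fun h => Fin.succAbove_ne _ _ (hinj h), _, rfl⟩
    · rintro ⟨hb, j, rfl⟩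
      obtain ⟨l, rfl⟩ := Fin.exists_succAbove_eq (show j ≠ i by rintro rfl; exact hb rfl)
      exact ⟨l, rfl⟩
  · refine card_biUnion_le.trans ((sum_le_card_nsmul _ _ (s ^ q) fun i _ => ?_).trans ?_)
    · refine card_image_le.trans ?_
      rw [Fintype.card_piFinset]
      simp [hs]
    · simp

end Partite

/-! ### Counting copies, palettes and colourings. -/

/-- The number of copies of `K_{s:m}` on `[n]`. -/
lemma card_balanced_le (m s n : ℕ) :
    Nat.card {G : Finset (Finset (Fin n)) // IsBalancedCompletePartite m s G} ≤ n ^ (m * s) := by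
  classical
  rw [Nat.card_eq_fintype_card, Fintype.card_subtype]
  have : (univ.filter fun G : Finset (Finset (Fin n)) => IsBalancedCompletePartite m s G) ⊆
      (univ : Finset (Fin m → Fin s → Fin n)).image (fun p =>
        univ.image fun g : Fin m → Fin s => univ.image fun i => p i (g i)) := by
    intro G hG
    obtain ⟨P, hP, hs, hG⟩ := (mem_filter.1 hG).2
    refine mem_image.2 ⟨fun i j => ((P i).equivFinOfCardEq (hs i)).symm j, mem_univ _, ?_⟩
    ext e
    rw [mem_iff_exists_transversal hP hG]
    simp only [mem_image, mem_univ, true_and]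
    constructor
    · rintro ⟨g, rfl⟩
      exact ⟨_, fun i => (((P i).equivFinOfCardEq (hs i)).symm (g i)).2, rfl⟩
    · rintro ⟨f, hf, rfl⟩
      refine ⟨fun i => (P i).equivFinOfCardEq (hs i) ⟨f i, hf i⟩, ?_⟩
      simp
  refine (card_le_card this).trans (card_image_le.trans ?_)
  simp only [card_univ, Fintype.card_pi, Fintype.card_fin, prod_const]
  rw [← pow_mul, mul_comm]

lemma f_le_mul (r n k s B : ℕ)
    (hB : ∀ G : Finset (Finset (Fin n)), IsBalancedCompletePartite (r - 1) s G →
      Nat.card {χ : {e // e ∈ G} → Fin n // IsColoring G χ ∧ ¬ ContainsCycle k (extension G χ)} ≤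
        B) :
    f r n k s ≤ n ^ ((r - 1) * s) * B := by
  classical
  let Φ : {p : (G : Finset (Finset (Fin n))) × ({e // e ∈ G} → Fin n) //
    IsBalancedCompletePartite (r - 1) s p.1 ∧ IsColoring p.1 p.2 ∧
      ¬ ContainsCycle k (extension p.1 p.2)} →
      (G : {G : Finset (Finset (Fin n)) // IsBalancedCompletePartite (r - 1) s G}) ×
        {χ : {e // e ∈ G.1} → Fin n // IsColoring G.1 χ ∧ ¬ ContainsCycle k (extension G.1 χ)} :=
    fun p => ⟨⟨p.1.1, p.2.1⟩, ⟨p.1.2, p.2.2⟩⟩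
  have hΦ : Function.Injective Φ := by
    rintro ⟨⟨G, χ⟩, h⟩ ⟨⟨G', χ'⟩, h'⟩ heq
    simp only [Φ, Sigma.mk.injEq, Subtype.mk.injEq] at heq
    obtain ⟨rfl, h2⟩ := heq
    simp only [heq_eq_eq, Subtype.mk.injEq] at h2
    subst h2
    rfl
  refine (Nat.card_le_card_of_injective Φ hΦ).trans ?_
  rw [Nat.card_sigma]
  refine (sum_le_card_nsmul _ _ B fun G _ => hB G.1 G.2).trans ?_
  rw [smul_eq_mul, card_univ, ← Nat.card_eq_fintype_card]
  exact Nat.mul_le_mul_right _ (card_balanced_le _ _ _)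

lemma exists_fin_image_superset {V : Type*} [DecidableEq V] [Nonempty V] (M : ℕ) (Z : Finset V)
    (hZ : Z.card ≤ M) : ∃ z : Fin M → V, Z ⊆ univ.image z := by
  refine ⟨fun i => if h : (i : ℕ) < Z.card then (Z.equivFin.symm ⟨i, h⟩ : V)
    else Classical.arbitrary V, fun a ha => ?_⟩
  refine mem_image.2 ⟨Fin.castLE hZ (Z.equivFin ⟨a, ha⟩), mem_univ _, ?_⟩
  simp

/-- Functions taking few values are counted by first choosing a palette. -/
lemma card_le_of_card_image_le {E V : Type*} [Fintype E] [Fintype V] [DecidableEq V] [Nonempty V]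
    (Q : (E → V) → Prop) (M B : ℕ) (hQ : ∀ χ, Q χ → (univ.image χ).card ≤ M)
    (hB : ∀ Z : Finset V, Z.card ≤ M → Nat.card {χ : E → V // (∀ e, χ e ∈ Z) ∧ Q χ} ≤ B) :
    Nat.card {χ // Q χ} ≤ Fintype.card V ^ M * B := by
  classical
  -- A palette is recorded as a list of length `M` with repetitions allowed, which gives the factor
  -- `|V| ^ M`.
  have hz : ∀ χ : {χ // Q χ}, ∃ z : Fin M → V, univ.image χ.1 ⊆ univ.image z :=
    fun χ => exists_fin_image_superset M _ (hQ _ χ.2)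
  choose z hz using hz
  let Φ : {χ // Q χ} → (z : Fin M → V) × {χ : E → V // (∀ e, χ e ∈ univ.image z) ∧ Q χ} :=
    fun χ => ⟨z χ, χ.1, fun e => hz χ (mem_image_of_mem _ (mem_univ e)), χ.2⟩
  have hΦ : Function.Injective Φ := by
    intro χ χ' h
    have h2 : (Φ χ).2.1 = (Φ χ').2.1 := by rw [h]
    exact Subtype.ext h2
  refine (Nat.card_le_card_of_injective Φ hΦ).trans ?_
  rw [Nat.card_sigma]
  refine (sum_le_card_nsmul _ _ B fun z _ => hB _ ?_).trans ?_
  · exact card_image_le.trans (by simp)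
  · simp

lemma extension_eq_image {V : Type*} [DecidableEq V] {G : Finset (Finset V)}
    {χ : {e // e ∈ G} → V} {c : Finset V → V} (hc : ∀ e : {e // e ∈ G}, c e = χ e) :
    extension G χ = G.image fun e => insert (c e) e := by
  ext T
  simp only [extension, mem_image, mem_univ, true_and, Subtype.exists]
  constructor
  · rintro ⟨e, he, rfl⟩
    exact ⟨e, he, by rw [hc ⟨e, he⟩, insert_eq, union_comm]⟩
  · rintro ⟨e, he, rfl⟩
    exact ⟨e, he, by rw [hc ⟨e, he⟩, insert_eq, union_comm]⟩

lemma exists_total {V : Type*} [Nonempty V] {G : Finset (Finset V)} (χ : {e // e ∈ G} → V) :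
    ∃ c : Finset V → V, ∀ e : {e // e ∈ G}, c e = χ e :=
  ⟨Function.extend Subtype.val χ (fun _ => Classical.arbitrary V),
    fun e => Subtype.val_injective.extend_apply _ _ e⟩

lemma image_eq_of_total {V : Type*} [DecidableEq V] {G : Finset (Finset V)}
    {χ : {e // e ∈ G} → V} {c : Finset V → V} (hc : ∀ e : {e // e ∈ G}, c e = χ e) :
    univ.image χ = G.image c := by
  ext z
  simp [← hc]

/-- One edge for each colour outside `W`. -/
lemma exists_rainbow_subfamily {α V : Type*} [DecidableEq α] [DecidableEq V] (G : Finset α)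
    (c : α → V) (W : Finset V) : ∃ H ⊆ G, H.card = (G.image c \ W).card ∧ Set.InjOn c H ∧
      ∀ e ∈ H, c e ∉ W := by
  have h : ∀ z : {z // z ∈ G.image c \ W}, ∃ e ∈ G, c e = z := fun z =>
    mem_image.1 (mem_sdiff.1 z.2).1
  choose g hg hgc using h
  have hinj : Function.Injective g := fun a b hab => Subtype.ext (by rw [← hgc, ← hgc, hab])
  refine ⟨univ.image g, ?_, ?_, ?_, ?_⟩
  · intro e he
    obtain ⟨z, -, rfl⟩ := mem_image.1 he
    exact hg z
  · rw [card_image_of_injective _ hinj, card_univ, Fintype.card_coe]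
  · intro a ha b hb hab
    obtain ⟨z, -, rfl⟩ := mem_image.1 (mem_coe.1 ha)
    obtain ⟨z', -, rfl⟩ := mem_image.1 (mem_coe.1 hb)
    rw [hgc, hgc] at hab
    rw [Subtype.ext hab]
  · intro e he
    obtain ⟨z, -, rfl⟩ := mem_image.1 he
    rw [hgc]
    exact (mem_sdiff.1 z.2).2

/-! ### Uniformity greater than three. -/

/-- The number of colours in a colouring of `K_{s:m}`, `m ≥ 3`, with `C_k`-free extension. -/
lemma card_colors_le {V : Type*} [DecidableEq V] [Nonempty V] {q s k : ℕ} (hq : 2 ≤ q) (hk : 3 ≤ k)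
    {G : Finset (Finset V)} (hbal : IsBalancedCompletePartite (q + 1) s G)
    {χ : {e // e ∈ G} → V} (hfree : ¬ ContainsCycle k (extension G χ)) :
    (univ.image χ).card ≤ (k * (q + 1) + k) * ((q + 1) * s ^ q) + (q + 1) * s := by
  obtain ⟨P, hP, hs, hG⟩ := hbal
  have hG' := mem_iff_exists_transversal hP hG
  obtain ⟨c, hc⟩ := exists_total χ
  rw [image_eq_of_total hc]
  rw [extension_eq_image hc] at hfree
  obtain ⟨S, hS, hScard⟩ := exists_shadow_superset hP hs (fun e he => (hG' e).1 he)
  -- Discarding the colours that are vertices of `G` costs at most `(q + 1) * s` and makes each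
  -- remaining colour a legal private vertex for `expand`.
  obtain ⟨H, hHG, hHcard, hinj, hout⟩ := exists_rainbow_subfamily G c (univ.biUnion P)
  by_contra! hlt
  have h1 := card_parts_le hs
  have h2 := le_card_sdiff (univ.biUnion P) (G.image c)
  obtain ⟨e, v, hev, he⟩ := exists_looseCycle_of_shadow (m := q + 1) (by omega) hk H S
    (fun e he => by
      obtain ⟨f, hf, rfl⟩ := (hG' e).1 (hHG he)
      exact card_image_transversal hP hf)
    (fun e he => hS e (hHG he))
    ((Nat.mul_le_mul_left _ hScard).trans_lt (by omega))
  refine hfree ((hev.expand (x := fun i => c (e i)) (by omega) ?_ ?_).containsCycle ?_)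
  · exact fun i j hij => hev.1 (hinj (he i) (he j) hij)
  · exact fun i j hij => hout _ (he i) (((hG _).1 (hHG (he j))).1 hij)
  · exact fun i => mem_image_of_mem _ (hHG (he i))

/-- Each of the at most `s ^ (r - 1)` edges is allowed every palette colour. This is affordable
because the target exponent contains `s ^ (r - 1) * log s`. -/
lemma f_le_of_three_lt (r n k s : ℕ) (hr : 3 < r) (hk : 3 ≤ k) (hs : 1 ≤ s) (hn : 1 ≤ n) :
    f r n k s ≤ n ^ ((r - 1) * s) * (n ^ (((k * r) * r + r) * s ^ (r - 2)) *
      (((k * r) * r + r) * s ^ (r - 2)) ^ s ^ (r - 1)) := by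
  have : Nonempty (Fin n) := ⟨⟨0, hn⟩⟩
  obtain ⟨q, rfl⟩ : ∃ q, r = q + 2 := ⟨r - 2, by omega⟩
  rw [show q + 2 - 2 = q by omega]
  refine f_le_mul _ _ _ _ _ fun G hG => ?_
  rw [show q + 2 - 1 = q + 1 by omega] at *
  have hpow : s ≤ s ^ q := Nat.le_self_pow (by omega) s
  have hM : 1 ≤ ((k * (q + 2)) * (q + 2) + (q + 2)) * s ^ q := Nat.mul_pos (by positivity) (by positivity)
  have hE : Fintype.card {e // e ∈ G} ≤ s ^ (q + 1) := by
    obtain ⟨P, hP, hs', hG⟩ := hG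
    rw [Fintype.card_coe]
    exact card_le_pow_of_transversal hs' fun e he => (mem_iff_exists_transversal hP hG e).1 he
  have key := card_le_of_card_image_le
    (fun χ : {e // e ∈ G} → Fin n => IsColoring G χ ∧ ¬ ContainsCycle k (extension G χ))
    (((k * (q + 2)) * (q + 2) + (q + 2)) * s ^ q)
    ((((k * (q + 2)) * (q + 2) + (q + 2)) * s ^ q) ^ s ^ (q + 1)) (fun χ hχ => by
      refine (card_colors_le (by omega) hk hG hχ.2).trans ?_
      have : (q + 1) * s ≤ (q + 2) * s ^ q := Nat.mul_le_mul (by omega) hpow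
      have h2 : (k * (q + 1) + k) * ((q + 1) * s ^ q) ≤ (k * (q + 2)) * ((q + 2) * s ^ q) :=
        Nat.mul_le_mul (by ring_nf; omega) (Nat.mul_le_mul_right _ (by omega))
      calc _ ≤ (k * (q + 2)) * ((q + 2) * s ^ q) + (q + 2) * s ^ q := add_le_add h2 this
        _ = _ := by ring)
    (fun Z hZ => by
      classical
      let Φ : {χ : {e // e ∈ G} → Fin n // (∀ e, χ e ∈ Z) ∧ IsColoring G χ ∧
        ¬ ContainsCycle k (extension G χ)} → ({e // e ∈ G} → Z) := fun χ e => ⟨χ.1 e, χ.2.1 e⟩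
      have hΦ : Function.Injective Φ := fun χ χ' h => Subtype.ext (funext fun e =>
        congrArg Subtype.val (congrFun h e))
      refine (Nat.card_le_card_of_injective Φ hΦ).trans ?_
      rw [Nat.card_eq_fintype_card, Fintype.card_fun, Fintype.card_coe Z]
      exact (Nat.pow_le_pow_left hZ _).trans (Nat.pow_le_pow_right hM hE))
  rwa [Fintype.card_fin] at key

/-- The case `n = 0` is separate because `Real.logb 2 0 = 0`, so that powers of `2` with exponent a
multiple of `logb 2 n` no longer express powers of `n`. -/
lemma f_zero (r k s : ℕ) (hr : 2 ≤ r) (hs : 1 ≤ s) : f r 0 k s = 0 := by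
  have h := f_le_mul r 0 k s 1 (fun G _ => Finite.card_le_one_iff_subsingleton.2
    ⟨fun χ χ' => Subtype.ext (funext fun e => (χ.1 e).elim0)⟩)
  have h0 : (0 : ℕ) ^ ((r - 1) * s) = 0 := zero_pow (Nat.mul_pos (by omega) hs).ne'
  rw [h0] at h
  omega

lemma rpow_logb_natCast {n : ℕ} (hn : 1 ≤ n) (a : ℕ) :
    (2 : ℝ) ^ ((a : ℝ) * Real.logb 2 n) = (n : ℝ) ^ a := by
  rw [mul_comm, Real.rpow_mul (by norm_num), Real.rpow_logb (by norm_num) (by norm_num)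
    (by exact_mod_cast hn), Real.rpow_natCast]

theorem f_le_of_uniformity_gt_three (r k : ℕ) (hr : 3 < r) (hk : 3 ≤ k) :
    ∃ c₂ : ℝ, 0 < c₂ ∧ ∀ n s : ℕ, 1 ≤ s →
      (f r n k s : ℝ) ≤
        (2 : ℝ) ^ ((c₂ + 2 * (r : ℝ)) * (s : ℝ) ^ (r - 2) * Real.logb 2 (n : ℝ)
          + (s : ℝ) ^ (r - 1) *
            (Real.logb 2 (c₂ + (r : ℝ)) + ((r : ℝ) - 2) * Real.logb 2 (s : ℝ))) := by
  refine ⟨((k * r * r : ℕ) : ℝ), by exact_mod_cast (by positivity), fun n s hs => ?_⟩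
  rcases Nat.eq_zero_or_pos n with rfl | hn
  · rw [f_zero r k s (by omega) hs]
    simp only [Nat.cast_zero]
    positivity
  have hM : 1 ≤ ((k * r) * r + r) * s ^ (r - 2) := Nat.mul_pos (by positivity) (by positivity)
  have h := f_le_of_three_lt r n k s hr hk hs hn
  rw [← mul_assoc, ← pow_add] at h
  -- The palette contributes `c₂ + r` and the choice of `G` at most a further `r`; hence `c₂ + 2r`
  -- with `c₂ = k * r * r`.
  have hexp : (r - 1) * s + ((k * r) * r + r) * s ^ (r - 2) ≤ (k * r * r + 2 * r) * s ^ (r - 2) := by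
    have hpow : s ≤ s ^ (r - 2) := Nat.le_self_pow (by omega) s
    have : (r - 1) * s ≤ r * s ^ (r - 2) := Nat.mul_le_mul (by omega) hpow
    nlinarith
  have h' := h.trans (Nat.mul_le_mul_right _ (Nat.pow_le_pow_right hn hexp))
  refine (Nat.cast_le.2 h').trans (le_of_eq ?_)
  rw [Real.rpow_add (by norm_num)]
  push_cast
  congr 1
  · have := rpow_logb_natCast hn ((k * r * r + 2 * r) * s ^ (r - 2))
    push_cast at this
    rw [this]
  · have := rpow_logb_natCast hM (s ^ (r - 1))
    push_cast at this
    rw [← this]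
    congr 2
    have hs0 : (s : ℝ) ≠ 0 := by positivity
    have hr0 : (k * r * r + r : ℝ) ≠ 0 := by positivity
    rw [Real.logb_mul hr0 (by positivity), Real.logb_pow, Nat.cast_sub (by omega)]
    norm_num

/-! ### Rainbow paths and cycles in bipartite graphs. -/

/-- A path in the graph `F` whose vertices `m 0, m 2, …, m (2 ℓ)` and whose edge colours
`m 1, m 3, …, m (2 ℓ - 1)` are all distinct. -/
def IsRainbowPath {V : Type*} [DecidableEq V] (F : Finset (Finset V)) (c : Finset V → V) (ℓ : ℕ)
    (m : ℕ → V) : Prop :=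
  (∀ i < ℓ, {m (2 * i), m (2 * i + 2)} ∈ F ∧ m (2 * i + 1) = c {m (2 * i), m (2 * i + 2)}) ∧
    Set.InjOn m (Set.Iic (2 * ℓ))

/-- A cycle in the graph `F` whose vertices `m 0, m 2, …` and whose edge colours `m 1, m 3, …` are
all distinct. -/
def IsRainbowCycle {V : Type*} [DecidableEq V] (F : Finset (Finset V)) (c : Finset V → V) (ℓ : ℕ)
    (m : ℕ → V) : Prop :=
  (∀ i < ℓ, {m (2 * i), m (2 * i + 2)} ∈ F ∧ m (2 * i + 1) = c {m (2 * i), m (2 * i + 2)}) ∧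
    Set.InjOn m (Set.Iio (2 * ℓ)) ∧ m (2 * ℓ) = m 0

section Rainbow
variable {V : Type*} [DecidableEq V] {F G : Finset (Finset V)} {c : Finset V → V}

lemma IsRainbowCycle.containsCycle {k : ℕ} {m : ℕ → V} (hk : 3 ≤ k) (h : IsRainbowCycle G c k m) :
    ContainsCycle k (G.image fun e => insert (c e) e) := by
  obtain ⟨h1, h2, h3⟩ := h
  have hpairs := isLooseCycle_pairs hk (w := fun i => m (2 * i))
    (fun i hi j hj hij => by
      simp only [Set.mem_Iio] at hi hj
      have := h2 (show 2 * i < 2 * k by omega) (show 2 * j < 2 * k by omega) hij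
      omega) (by simpa using h3)
  have hodd : ∀ i j : ℕ, i < k → j ≤ k → m (2 * i + 1) ≠ m (2 * j) := by
    intro i j hi hj hij
    rcases hj.lt_or_eq with hj | rfl
    · have := h2 (show 2 * i + 1 < 2 * k by omega) (show 2 * j < 2 * k by omega) hij
      omega
    · rw [h3] at hij
      have := h2 (show 2 * i + 1 < 2 * j by omega) (show 0 < 2 * j by omega) hij
      omega
  refine (hpairs.expand (x := fun i => m (2 * i + 1)) (by omega) ?_ ?_).containsCycle ?_
  · intro i j hij
    have hi := i.2
    have hj := j.2
    have := h2 (show 2 * (i : ℕ) + 1 < 2 * k by omega) (show 2 * (j : ℕ) + 1 < 2 * k by omega) hij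
    ext; omega
  · intro i j
    have hi := i.2
    have hj := j.2
    simp only [mem_insert, mem_singleton, not_or]
    exact ⟨hodd i j (by omega) (by omega), hodd i (j + 1) (by omega) (by omega)⟩
  · intro i
    obtain ⟨h4, h5⟩ := h1 i i.2
    exact mem_image.2 ⟨_, h4, by rw [← h5]; rfl⟩

/-- Two graphs occur because the path runs in a sparse subgraph `F`, while the closing edge may be
any edge of the complete bipartite graph `G`. -/
lemma IsRainbowPath.close {ℓ : ℕ} {m : ℕ → V} (h : IsRainbowPath F c ℓ m) (hFG : F ⊆ G)
    (he : {m (2 * ℓ), m 0} ∈ G) (hc : ∀ i ≤ 2 * ℓ, c {m (2 * ℓ), m 0} ≠ m i) :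
    ∃ m', IsRainbowCycle G c (ℓ + 1) m' := by
  obtain ⟨h1, h2⟩ := h
  refine ⟨fun i => if i ≤ 2 * ℓ then m i else if i = 2 * ℓ + 1 then c {m (2 * ℓ), m 0} else m 0,
    ?_, ?_, ?_⟩
  · intro i hi
    rcases Nat.lt_succ_iff_lt_or_eq.1 hi with hi | rfl
    · simp only [show 2 * i ≤ 2 * ℓ by omega, show 2 * i + 1 ≤ 2 * ℓ by omega,
        show 2 * i + 2 ≤ 2 * ℓ by omega, if_true]
      exact ⟨hFG (h1 i hi).1, (h1 i hi).2⟩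
    · simp [he]
  · intro i hi j hj hij
    simp only [Set.mem_Iio] at hi hj hij
    split_ifs at hij with h3 h4 h5 h6 h7 h8
    · exact h2 h3 h4 hij
    · exact absurd hij.symm (hc i h3)
    · omega
    · exact absurd hij (hc j (by assumption))
    all_goals omega
  · simp; intro h; omega

lemma IsRainbowPath.extend {ℓ : ℕ} {m : ℕ → V} (h : IsRainbowPath F c ℓ m) {w : V}
    (he : {m (2 * ℓ), w} ∈ F) (hw : ∀ i ≤ 2 * ℓ, w ≠ m i)
    (hc : ∀ i ≤ 2 * ℓ, c {m (2 * ℓ), w} ≠ m i) (hcw : c {m (2 * ℓ), w} ≠ w) :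
    IsRainbowPath F c (ℓ + 1)
      (fun i => if i ≤ 2 * ℓ then m i else if i = 2 * ℓ + 1 then c {m (2 * ℓ), w} else w) := by
  obtain ⟨h1, h2⟩ := h
  refine ⟨?_, ?_⟩
  · intro i hi
    rcases Nat.lt_succ_iff_lt_or_eq.1 hi with hi | rfl
    · simp only [show 2 * i ≤ 2 * ℓ by omega, show 2 * i + 1 ≤ 2 * ℓ by omega,
        show 2 * i + 2 ≤ 2 * ℓ by omega, if_true]
      exact h1 i hi
    · simp [he]
  · intro i hi j hj hij
    simp only [Set.mem_Iic] at hi hj hij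
    split_ifs at hij with h3 h4 h5 h6 h7 h8 h9 h10
    · exact h2 h3 h4 hij
    · exact absurd hij.symm (hc i h3)
    · exact absurd hij.symm (hw i h3)
    · exact absurd hij (hc j (by assumption))
    · omega
    · exact absurd hij hcw
    · exact absurd hij (hw j (by assumption))
    · exact absurd hij.symm hcw
    · omega

/-- A cycle in a graph with distinct edge colours that are not vertices is a rainbow cycle. -/
lemma exists_isRainbowCycle_of_cycle (hinj : Set.InjOn c F)
    (hout : ∀ e ∈ F, ∀ e' ∈ F, c e ∉ e') {L : ℕ} (hL : 3 ≤ L) {w : ℕ → V}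
    (hw : Set.InjOn w (Set.Iio L)) (hwL : w L = w 0) (hF : ∀ i < L, {w i, w (i + 1)} ∈ F) :
    ∃ m, IsRainbowCycle F c L m := by
  have hpairs := (isLooseCycle_pairs hL hw hwL).1
  refine ⟨fun i => if i % 2 = 0 then w (i / 2) else c {w (i / 2), w (i / 2 + 1)}, ?_, ?_, ?_⟩
  · intro i hi
    simp only [show (2 * i) % 2 = 0 by omega, show (2 * i + 2) % 2 = 0 by omega,
      show ¬ ((2 * i + 1) % 2 = 0) by omega, if_true, if_false, show (2 * i) / 2 = i by omega,
      show (2 * i + 2) / 2 = i + 1 by omega, show (2 * i + 1) / 2 = i by omega]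
    exact ⟨hF i hi, trivial⟩
  · intro i hi j hj hij
    simp only [Set.mem_Iio] at hi hj hij
    split_ifs at hij with h1 h2 h3
    · have := hw (show i / 2 < L by omega) (show j / 2 < L by omega) hij
      omega
    · refine absurd ?_ (hout _ (hF (j / 2) (by omega)) _ (hF (i / 2) (by omega)))
      rw [← hij]; simp
    · refine absurd ?_ (hout _ (hF (i / 2) (by omega)) _ (hF (j / 2) (by omega)))
      rw [hij]; simp
    · have h4 := hinj (hF (i / 2) (by omega)) (hF (j / 2) (by omega)) hij
      have h5 := @hpairs ⟨i / 2, by omega⟩ ⟨j / 2, by omega⟩ h4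
      simp only [Fin.mk.injEq] at h5
      omega
  · simpa using hwL

variable {X Y : Finset V}

lemma pair_mem_iff (hG : ∀ e, e ∈ G ↔ ∃ x ∈ X, ∃ y ∈ Y, e = {x, y}) (u w : V) :
    {u, w} ∈ G ↔ (u ∈ X ∧ w ∈ Y) ∨ (u ∈ Y ∧ w ∈ X) := by
  rw [hG]
  constructor
  · rintro ⟨x, hx, y, hy, h⟩
    have h1 : u ∈ ({x, y} : Finset V) := by rw [← h]; simp
    have h2 : w ∈ ({x, y} : Finset V) := by rw [← h]; simp
    have h3 : x ∈ ({u, w} : Finset V) := by rw [h]; simp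
    have h4 : y ∈ ({u, w} : Finset V) := by rw [h]; simp
    simp only [mem_insert, mem_singleton] at h1 h2 h3 h4
    rcases h1 with rfl | rfl <;> rcases h2 with rfl | rfl <;> simp_all
  · rintro (⟨h1, h2⟩ | ⟨h1, h2⟩)
    · exact ⟨u, h1, w, h2, rfl⟩
    · exact ⟨w, h2, u, h1, pair_comm _ _⟩

lemma pair_mem_of_three (hXY : Disjoint X Y) (hG : ∀ e, e ∈ G ↔ ∃ x ∈ X, ∃ y ∈ Y, e = {x, y})
    {a b d e : V} (h1 : {a, b} ∈ G) (h2 : {b, d} ∈ G) (h3 : {d, e} ∈ G) : {a, e} ∈ G := by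
  rw [pair_mem_iff hG] at *
  have hb : b ∈ X → b ∉ Y := fun h => disjoint_left.1 hXY h
  have hd : d ∈ X → d ∉ Y := fun h => disjoint_left.1 hXY h
  tauto

lemma mem_iff_notMem_of_pair_mem (hXY : Disjoint X Y)
    (hG : ∀ e, e ∈ G ↔ ∃ x ∈ X, ∃ y ∈ Y, e = {x, y}) {u w : V} (h : {u, w} ∈ G) :
    u ∈ X ↔ w ∉ X := by
  rw [pair_mem_iff hG] at h
  have hu : u ∈ X → u ∉ Y := fun h => disjoint_left.1 hXY h
  have hw : w ∈ X → w ∉ Y := fun h => disjoint_left.1 hXY h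
  tauto

/-- Vertices at odd distance along a walk in a complete bipartite graph are adjacent. -/
lemma pair_mem_of_odd (hXY : Disjoint X Y) (hG : ∀ e, e ∈ G ↔ ∃ x ∈ X, ∃ y ∈ Y, e = {x, y})
    (w : ℕ → V) (j : ℕ) (h : ∀ i < 2 * j + 1, {w i, w (i + 1)} ∈ G) : {w 0, w (2 * j + 1)} ∈ G := by
  induction j with
  | zero => exact h 0 (by omega)
  | succ j ih =>
    exact pair_mem_of_three hXY hG (ih fun i hi => h i (by omega)) (h (2 * j + 1) (by omega))
      (h (2 * j + 2) (by omega))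

/-- Cutting a rainbow cycle along chords. -/
lemma exists_isRainbowCycle_of_long (hXY : Disjoint X Y)
    (hG : ∀ e, e ∈ G ↔ ∃ x ∈ X, ∃ y ∈ Y, e = {x, y}) (hc : ∀ e ∈ G, c e ∉ e) {p : ℕ} (hp : 2 ≤ p)
    (t : ℕ) : ∀ m : ℕ → V, IsRainbowCycle G c (2 + (2 * p - 2) * (t + 1)) m →
      ∃ m', IsRainbowCycle G c (2 * p) m' := by
  induction t with
  | zero =>
    intro m hm
    rw [show 2 + (2 * p - 2) * (0 + 1) = 2 * p by omega] at hm
    exact ⟨m, hm⟩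
  | succ t ih =>
    rintro m ⟨h1, h2, h3⟩
    obtain ⟨q, rfl⟩ : ∃ q, p = q + 1 := ⟨p - 1, by omega⟩
    rw [show 2 * (q + 1) - 2 = 2 * q by omega] at *
    have hL : 2 + 2 * q * (t + 1 + 1) = (2 + 2 * q * (t + 1)) + 2 * q := by ring
    rw [hL] at h1 h2 h3
    have hpos : 0 < 2 * q * (t + 1) := by
      have : 0 < q := by omega
      positivity
    set L := 2 + 2 * q * (t + 1) with hLdef
    have hedge : {m (2 * (2 * q + 1)), m 0} ∈ G := by
      rw [pair_comm]
      exact pair_mem_of_odd hXY hG (fun i => m (2 * i)) q (fun i hi => (h1 i (by omega)).1)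
    -- The chord closes an arc of `2q + 1` edges to a cycle of length `2p`. If its colour is new on
    -- that arc, this cycle is rainbow. Otherwise its colour lies inside that arc, hence not on the
    -- complementary arc, which the chord closes to a rainbow cycle shorter by `2q`.
    by_cases hz : ∀ i ≤ 2 * (2 * q + 1), c {m (2 * (2 * q + 1)), m 0} ≠ m i
    · exact IsRainbowPath.close (F := G) (ℓ := 2 * q + 1) (m := m)
        ⟨fun i hi => h1 i (by omega), h2.mono fun i hi => by
          simp only [Set.mem_Iic, Set.mem_Iio] at *; omega⟩ Subset.rfl hedge hz
    push Not at hz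
    obtain ⟨a, ha, hza⟩ := hz
    have hnot := hc _ hedge
    have ha0 : a ≠ 0 := by
      rintro rfl; rw [hza] at hnot; simp at hnot
    have ha1 : a ≠ 2 * (2 * q + 1) := by
      rintro rfl; rw [hza] at hnot; simp at hnot
    apply ih (fun i => if i = 0 then m 0 else if i = 1 then m a else m (i + 4 * q))
    refine ⟨?_, ?_, ?_⟩
    · intro i hi
      rcases Nat.eq_zero_or_pos i with rfl | hi0
      · simp only [Nat.mul_zero, Nat.zero_add, if_true, one_ne_zero, if_false, OfNat.ofNat_ne_zero,
          show ¬ ((2 : ℕ) = 1) by omega]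
        rw [show 2 + 4 * q = 2 * (2 * q + 1) by omega, pair_comm, hza]
        exact ⟨hedge, rfl⟩
      · simp only [show ¬ (2 * i = 0) by omega, show ¬ (2 * i = 1) by omega,
          show ¬ (2 * i + 1 = 0) by omega, show ¬ (2 * i + 1 = 1) by omega,
          show ¬ (2 * i + 2 = 0) by omega, show ¬ (2 * i + 2 = 1) by omega, if_false]
        have := h1 (i + 2 * q) (by omega)
        rw [show 2 * (i + 2 * q) = 2 * i + 4 * q by omega,
          show 2 * i + 4 * q + 1 = 2 * i + 1 + 4 * q by omega,
          show 2 * i + 4 * q + 2 = 2 * i + 2 + 4 * q by omega] at this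
        exact this
    · intro i hi j hj hij
      simp only [Set.mem_Iio] at hi hj hij
      have hcan : ∀ a b, a < 2 * (L + 2 * q) → b < 2 * (L + 2 * q) → m a = m b → a = b :=
        fun a b ha hb h => h2 ha hb h
      split_ifs at hij <;> first
        | omega
        | (have := hcan _ _ (by omega) (by omega) hij; omega)
    · simp only [show ¬ (2 * L = 0) by omega, show ¬ (2 * L = 1) by omega, if_false, if_true]
      rw [← h3]; congr 1; omega

/-- A graph of minimum degree at least `p` with distinct external colours inside a complete bipartite
graph yields a long rainbow cycle of controlled length. -/
lemma exists_long_isRainbowCycle [Fintype V] (hXY : Disjoint X Y)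
    (hG : ∀ e, e ∈ G ↔ ∃ x ∈ X, ∃ y ∈ Y, e = {x, y}) (hFG : F ⊆ G) (hinj : Set.InjOn c F)
    (hout : ∀ e ∈ F, ∀ e' ∈ F, c e ∉ e') {p : ℕ} (hp : 2 ≤ p) (hne : F.Nonempty)
    (hdeg : ∀ u, ∀ e ∈ F, u ∈ e → p - 1 < (F.filter (fun e => u ∈ e)).card) :
    ∃ t m, IsRainbowCycle F c (2 + (2 * p - 2) * (t + 1)) m := by
  -- A longest path is sought; the last clause lets the degree condition apply at its end even when
  -- `ℓ = 0`.
  let P : ℕ → Prop := fun ℓ => ∃ v : ℕ → V, (∀ i < ℓ, {v i, v (i + 1)} ∈ F) ∧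
    Set.InjOn v (Set.Iic ℓ) ∧ ∃ e ∈ F, v ℓ ∈ e
  have hP0 : P 0 := by
    obtain ⟨e, he⟩ := hne
    obtain ⟨x, -, y, -, rfl⟩ := (hG e).1 (hFG he)
    exact ⟨fun _ => x, by simp, fun i hi j hj _ => by simp at hi hj; omega, _, he, by simp⟩
  have hmax : ∃ ℓ, P ℓ ∧ ¬ P (ℓ + 1) := by
    by_contra! h
    have hall : ∀ ℓ, P ℓ := fun ℓ => Nat.rec hP0 (fun n hn => h n hn) ℓ
    obtain ⟨v, -, hv, -⟩ := hall (Fintype.card V)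
    have h1 := card_le_card_of_injOn (s := Finset.Iic (Fintype.card V)) (t := univ) v (by simp)
      (by simpa using hv)
    simp at h1
  obtain ⟨ℓ, ⟨v, hpath, hv, e0, he0, hve0⟩, hmax⟩ := hmax
  -- By maximality, all neighbours of the end vertex lie on the path.
  have hnb : ∀ e : {e // e ∈ F.filter (fun e => v ℓ ∈ e)}, ∃ j < ℓ, {v ℓ, v j} = e.1 := by
    rintro ⟨e, he⟩
    obtain ⟨he, hle⟩ := mem_filter.1 he
    obtain ⟨w, hw, hww⟩ : ∃ w, w ≠ v ℓ ∧ {v ℓ, w} = e := by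
      obtain ⟨x, hx, y, hy, rfl⟩ := (hG e).1 (hFG he)
      have hxy : x ≠ y := fun h => disjoint_left.1 hXY hx (h ▸ hy)
      rcases mem_insert.1 hle with h | h
      · exact ⟨y, by rw [h]; exact hxy.symm, by rw [h]⟩
      · rw [mem_singleton] at h
        exact ⟨x, by rw [h]; exact hxy, by rw [h, pair_comm]⟩
    subst hww
    by_contra! hcon
    have hwv : ∀ j ≤ ℓ, v j ≠ w := by
      intro j hj hjw
      rcases hj.lt_or_eq with hj | rfl
      · exact hcon j hj (by rw [hjw])
      · exact hw hjw.symm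
    refine hmax ⟨fun i => if i ≤ ℓ then v i else w, ?_, ?_, _, he, by simp⟩
    · intro i hi
      rcases Nat.lt_succ_iff_lt_or_eq.1 hi with hi | rfl
      · simp only [show i ≤ ℓ by omega, show i + 1 ≤ ℓ by omega, if_true]
        exact hpath i hi
      · simpa using he
    · intro i hi j hj hij
      simp only [Set.mem_Iic] at hi hj hij
      split_ifs at hij with h1 h2 h3
      · exact hv h1 h2 hij
      · exact absurd hij (hwv i h1)
      · exact absurd hij.symm (hwv j h3)
      · omega
  choose J hJ hJe using hnb
  have hpar : ∀ j, ∀ i, j + i ≤ ℓ → (v (j + i) ∈ X ↔ (v j ∈ X ↔ Even i)) := by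
    intro j i
    induction i with
    | zero => simp
    | succ i ih =>
      intro h
      have h1 := ih (by omega)
      have h2 := mem_iff_notMem_of_pair_mem hXY hG (hFG (hpath (j + i) (by omega)))
      rw [Nat.even_add_one, ← add_assoc]
      tauto
  have hodd : ∀ e, (ℓ - J e) % 2 = 1 := by
    intro e
    have h1 := hpar (J e) (ℓ - J e) (by have := hJ e; omega)
    rw [show J e + (ℓ - J e) = ℓ by have := hJ e; omega] at h1
    have h2 := mem_iff_notMem_of_pair_mem hXY hG (u := v ℓ) (w := v (J e))
      (by rw [hJe]; exact hFG (mem_filter.1 e.2).1)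
    rw [← Nat.odd_iff, ← Nat.not_even_iff_odd]
    tauto
  -- The neighbours' positions have equal parity, so agreement of their halves modulo `p - 1` makes
  -- them differ by a multiple of `2p - 2`. The path between them and the end vertex form the cycle,
  -- which explains the extra `2` in its length.
  obtain ⟨e, -, e', -, hee, hmod⟩ := exists_ne_map_eq_of_card_lt_of_maps_to
    (s := (univ : Finset {e // e ∈ F.filter (fun e => v ℓ ∈ e)})) (t := range (p - 1))
    (f := fun e => (J e / 2) % (p - 1))
    (by rw [card_univ, Fintype.card_coe, card_range]; exact hdeg _ e0 he0 hve0)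
    (fun e _ => by simpa using Nat.mod_lt _ (by omega))
  have main : ∀ e e' : {e // e ∈ F.filter (fun e => v ℓ ∈ e)}, J e < J e' →
      (J e / 2) % (p - 1) = (J e' / 2) % (p - 1) →
      ∃ t m, IsRainbowCycle F c (2 + (2 * p - 2) * (t + 1)) m := by
    intro e e' hlt hmod
    have h1 := hodd e
    have h2 := hodd e'
    have h3 := hJ e'
    obtain ⟨t, ht⟩ := (Nat.modEq_iff_dvd' (by omega)).1 hmod
    have ht0 : t ≠ 0 := by
      rintro rfl
      simp at ht
      omega
    obtain ⟨t, rfl⟩ := Nat.exists_eq_succ_of_ne_zero ht0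
    obtain ⟨q, rfl⟩ : ∃ q, p = q + 1 := ⟨p - 1, by omega⟩
    have hD : J e' - J e = (2 * (q + 1) - 2) * (t + 1) := by
      rw [show 2 * (q + 1) - 2 = 2 * q by omega, mul_assoc]
      simp only [Nat.add_sub_cancel, Nat.succ_eq_add_one] at ht
      omega
    refine ⟨t, ?_⟩
    rw [← hD]
    set a := J e with ha
    set b := J e' with hb
    refine exists_isRainbowCycle_of_cycle hinj hout (by omega)
      (w := fun i => if i ≤ b - a then v (a + i) else if i = b - a + 1 then v ℓ else v a) ?_ ?_ ?_
    · intro i hi j hj hij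
      simp only [Set.mem_Iio] at hi hj hij
      have hcan : ∀ a b, a ≤ ℓ → b ≤ ℓ → v a = v b → a = b := fun a b ha hb h => hv ha hb h
      split_ifs at hij <;> first
        | omega
        | (have := hcan _ _ (by omega) (by omega) hij; omega)
    · simp; intro h; omega
    · intro i hi
      rcases lt_trichotomy i (b - a) with h | h | h
      · simp only [show i ≤ b - a by omega, show i + 1 ≤ b - a by omega, if_true]
        exact hpath (a + i) (by omega)
      · subst h
        simp only [le_refl, if_true, show ¬ (b - a + 1 ≤ b - a) by omega, if_false]
        rw [show a + (b - a) = b by omega, pair_comm, hb, hJe]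
        exact (mem_filter.1 e'.2).1
      · obtain rfl : i = b - a + 1 := by omega
        simp only [if_true, show ¬ (b - a + 1 ≤ b - a) by omega, if_false,
          show ¬ (b - a + 1 + 1 ≤ b - a) by omega, show ¬ (b - a + 1 + 1 = b - a + 1) by omega]
        rw [ha, hJe]
        exact (mem_filter.1 e.2).1
  have hJne : J e ≠ J e' := fun h => hee (Subtype.ext (by rw [← hJe, ← hJe, h]))
  rcases hJne.lt_or_gt with h | h
  · exact main e e' h hmod
  · exact main e' e h hmod.symm

/-- The number of colours in a colouring of `K_{s,s}` with `C_{2p}`-free extension. -/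
lemma card_image_le_of_free [Fintype V] (hXY : Disjoint X Y)
    (hG : ∀ e, e ∈ G ↔ ∃ x ∈ X, ∃ y ∈ Y, e = {x, y}) (hc : ∀ e ∈ G, c e ∉ e) {p s : ℕ}
    (hp : 2 ≤ p) (hX : X.card = s) (hY : Y.card = s)
    (hfree : ¬ ContainsCycle (2 * p) (G.image fun e => insert (c e) e)) :
    (G.image c).card ≤ 2 * p * s := by
  obtain ⟨H, hHG, hHcard, hinj, hout⟩ := exists_rainbow_subfamily G c (X ∪ Y)
  by_contra! hlt
  have h1 : (X ∪ Y).card ≤ 2 * s := (card_union_le _ _).trans (by omega)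
  have h2 := le_card_sdiff (X ∪ Y) (G.image c)
  -- The bound `2ps` splits into `2s` colours that may be vertices and `(p - 1) * 2s` edges that
  -- force minimum degree `p`.
  have h3 : (p - 1) * (2 * s) + 2 * s = 2 * p * s := by
    obtain ⟨q, rfl⟩ : ∃ q, p = q + 1 := ⟨p - 1, by omega⟩
    rw [Nat.add_sub_cancel]; ring
  have h4 : (p - 1) * (X ∪ Y).card ≤ (p - 1) * (2 * s) := Nat.mul_le_mul_left _ h1
  obtain ⟨F, hFH, hne, hdeg⟩ := exists_subset_degree (fun (e : Finset V) (u : V) => u ∈ e) (p - 1) _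
    H (X ∪ Y) rfl (by omega)
  have hsub : ∀ e ∈ G, e ⊆ X ∪ Y := by
    intro e he
    obtain ⟨x, hx, y, hy, rfl⟩ := (hG e).1 he
    intro z
    simp only [mem_insert, mem_singleton, mem_union]
    rintro (rfl | rfl)
    · exact Or.inl hx
    · exact Or.inr hy
  obtain ⟨t, m, h5, h6⟩ := exists_long_isRainbowCycle hXY hG (hFH.trans hHG)
    (hinj.mono (coe_subset.2 hFH))
    (fun e he e' he' h => hout e (hFH he) (hsub e' (hHG (hFH he')) h)) hp hne
    (fun u e he hue => hdeg u (hsub e (hHG (hFH he)) hue) e he hue)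
  obtain ⟨m', hm'⟩ := exists_isRainbowCycle_of_long hXY hG hc hp t m
    ⟨fun i hi => ⟨hHG (hFH (h5 i hi).1), (h5 i hi).2⟩, h6⟩
  exact hfree (hm'.containsCycle (by omega))

end Rainbow

/-! ### Edges whose colour is rare at both ends. -/

section Thin
variable {V : Type*} [DecidableEq V] {F G : Finset (Finset V)} {c : Finset V → V} {X Y : Finset V}

lemma pair_right_injective (u : V) : Function.Injective fun w => ({u, w} : Finset V) := by
  intro w w' h
  have h : ({u, w} : Finset V) = {u, w'} := h
  have h1 : w ∈ ({u, w'} : Finset V) := by rw [← h]; simp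
  have h2 : w' ∈ ({u, w} : Finset V) := by rw [h]; simp
  simp only [mem_insert, mem_singleton] at h1 h2
  rcases h1 with rfl | rfl
  · rcases h2 with rfl | rfl <;> rfl
  · rfl

/-- The number of edges of `G` at `u` with colour `z`. -/
def colorDegree (G : Finset (Finset V)) (c : Finset V → V) (u z : V) : ℕ :=
  (G.filter fun e => u ∈ e ∧ c e = z).card

variable [Fintype V]

/-- The neighbours of `u` in the graph `F`. -/
def nbrs (F : Finset (Finset V)) (u : V) : Finset V := univ.filter fun w => {u, w} ∈ F

lemma mem_nbrs {u w : V} : w ∈ nbrs F u ↔ {u, w} ∈ F := by simp [nbrs]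

lemma degree_le_card_nbrs (hG : ∀ e, e ∈ G ↔ ∃ x ∈ X, ∃ y ∈ Y, e = {x, y}) (hFG : F ⊆ G) (u : V) :
    (F.filter fun e => u ∈ e).card ≤ (nbrs F u).card := by
  refine (card_le_card ?_).trans (card_image_le (f := fun w => ({u, w} : Finset V)))
  intro e he
  obtain ⟨he, hu⟩ := mem_filter.1 he
  obtain ⟨x, hx, y, hy, rfl⟩ := (hG e).1 (hFG he)
  rw [mem_insert, mem_singleton] at hu
  rcases hu with rfl | rfl
  · exact mem_image.2 ⟨y, mem_nbrs.2 he, rfl⟩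
  · exact mem_image.2 ⟨x, mem_nbrs.2 (by rwa [pair_comm]), pair_comm _ _⟩

lemma card_nbrs_filter_le (F : Finset (Finset V)) (c : Finset V → V) (u z : V) :
    ((nbrs F u).filter fun w => c {u, w} = z).card ≤ colorDegree F c u z := by
  refine card_le_card_of_injOn (fun w => {u, w}) ?_ (pair_right_injective u).injOn
  intro w hw
  obtain ⟨h1, h2⟩ := mem_filter.1 (mem_coe.1 hw)
  exact mem_coe.2 (mem_filter.2 ⟨mem_nbrs.1 h1, by simp, h2⟩)

/-- If the colour class at `u` contains an edge of `F`, thinness of that one edge bounds the whole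
class; otherwise it is empty. -/
lemma card_nbrs_filter_le_of_thin (hFG : F ⊆ G) {d : ℕ}
    (hthin : ∀ e ∈ F, ∀ u ∈ e, colorDegree G c u (c e) ≤ d) (u z : V) :
    ((nbrs F u).filter fun w => c {u, w} = z).card ≤ d := by
  rcases ((nbrs F u).filter fun w => c {u, w} = z).eq_empty_or_nonempty with h | ⟨w, hw⟩
  · simp [h]
  · obtain ⟨h1, h2⟩ := mem_filter.1 hw
    have h3 := hthin _ (mem_nbrs.1 h1) u (by simp)
    rw [h2] at h3
    refine (card_nbrs_filter_le F c u z).trans (le_trans (card_le_card ?_) h3)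
    exact filter_subset_filter _ hFG

lemma card_nbrs_le (hXY : Disjoint X Y) (hG : ∀ e, e ∈ G ↔ ∃ x ∈ X, ∃ y ∈ Y, e = {x, y}) {s : ℕ}
    (hX : X.card = s) (hY : Y.card = s) (u : V) : (nbrs G u).card ≤ s := by
  by_cases hu : u ∈ X
  · rw [← hY]
    refine card_le_card fun w hw => ?_
    rw [mem_nbrs, pair_mem_iff hG] at hw
    have : u ∉ Y := disjoint_left.1 hXY hu
    tauto
  · rw [← hX]
    refine card_le_card fun w hw => ?_
    rw [mem_nbrs, pair_mem_iff hG] at hw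
    tauto

/-- The vertices that extend a rainbow path avoiding the set `B`. -/
def extenders (F : Finset (Finset V)) (c : Finset V → V) (B : Finset V) (ℓ : ℕ) (m : ℕ → V) :
    Finset V :=
  (nbrs F (m (2 * ℓ))).filter fun w => w ∉ B ∪ (range (2 * ℓ + 1)).image m ∧
    c {m (2 * ℓ), w} ∉ B ∪ (range (2 * ℓ + 1)).image m

/-- Each forbidden element excludes at most one neighbour as a vertex and at most `d` as a colour,
hence the factor `d + 1`. -/
lemma card_nbrs_le_card_extenders (hFG : F ⊆ G) {d : ℕ}
    (hthin : ∀ e ∈ F, ∀ u ∈ e, colorDegree G c u (c e) ≤ d) (B : Finset V) (ℓ : ℕ) (m : ℕ → V) :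
    (nbrs F (m (2 * ℓ))).card ≤
      (extenders F c B ℓ m).card + (d + 1) * (B.card + (2 * ℓ + 1)) := by
  set A := B ∪ (range (2 * ℓ + 1)).image m with hA
  have hAcard : A.card ≤ B.card + (2 * ℓ + 1) :=
    (card_union_le _ _).trans (Nat.add_le_add_left (card_image_le.trans (by simp)) _)
  have hsub : nbrs F (m (2 * ℓ)) ⊆ extenders F c B ℓ m ∪
      (A ∪ A.biUnion fun z => (nbrs F (m (2 * ℓ))).filter fun w => c {m (2 * ℓ), w} = z) := by
    intro w hw
    simp only [mem_union, mem_biUnion, mem_filter, extenders, ← hA]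
    by_cases h1 : w ∈ A
    · exact Or.inr (Or.inl h1)
    · by_cases h2 : c {m (2 * ℓ), w} ∈ A
      · exact Or.inr (Or.inr ⟨_, h2, hw, rfl⟩)
      · exact Or.inl ⟨hw, h1, h2⟩
  have h1 := (card_le_card hsub).trans ((card_union_le _ _).trans
    (Nat.add_le_add_left (card_union_le _ _) _))
  have h2 : (A.biUnion fun z =>
      (nbrs F (m (2 * ℓ))).filter fun w => c {m (2 * ℓ), w} = z).card ≤ A.card * d :=
    card_biUnion_le_card_mul _ _ _ fun z _ => card_nbrs_filter_le_of_thin hFG hthin _ _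
  have h3 : A.card * d ≤ (B.card + (2 * ℓ + 1)) * d := Nat.mul_le_mul_right _ hAcard
  have h4 : (d + 1) * (B.card + (2 * ℓ + 1)) =
    (B.card + (2 * ℓ + 1)) * d + (B.card + (2 * ℓ + 1)) := by ring
  omega

/-- A rainbow path starting in `v` whose other vertices and whose colours avoid `B`. -/
def IsAvoidingPath (F : Finset (Finset V)) (c : Finset V → V) (B : Finset V) (v : V) (ℓ : ℕ)
    (m : ℕ → V) : Prop :=
  IsRainbowPath F c ℓ m ∧ m 0 = v ∧ (∀ i, 1 ≤ i → i ≤ 2 * ℓ → m i ∉ B) ∧ ∃ e ∈ F, m (2 * ℓ) ∈ e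

/-- Appending the vertex `w` to a path of length `ℓ`. -/
def append (c : Finset V → V) (ℓ : ℕ) (m : ℕ → V) (w : V) : ℕ → V :=
  fun i => if i ≤ 2 * ℓ then m i else if i = 2 * ℓ + 1 then c {m (2 * ℓ), w} else w

lemma IsAvoidingPath.append {B : Finset V} {v : V} {ℓ : ℕ} {m : ℕ → V}
    (hc : ∀ e ∈ F, c e ∉ e) (h : IsAvoidingPath F c B v ℓ m) {w : V}
    (hw : w ∈ extenders F c B ℓ m) : IsAvoidingPath F c B v (ℓ + 1) (append c ℓ m w) := by
  obtain ⟨h1, h2, h3, -⟩ := h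
  simp only [extenders, mem_filter, mem_nbrs, mem_union, mem_image, mem_range, not_or, not_exists,
    not_and] at hw
  obtain ⟨hwF, ⟨hwB, hwm⟩, hcB, hcm⟩ := hw
  refine ⟨h1.extend hwF (fun i hi h => hwm i (by omega) h.symm)
    (fun i hi h => hcm i (by omega) h.symm) (fun h => ?_), ?_, ?_, _, hwF, ?_⟩
  · refine hc _ hwF ?_
    rw [h]; simp
  · simp [LooseCycle.append, h2]
  · intro i hi1 hi
    simp only [LooseCycle.append]
    split_ifs with h4 h5
    · exact h3 i hi1 h4
    · exact hcB
    · exact hwB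
  · simp [LooseCycle.append, show ¬ (2 * (ℓ + 1) ≤ 2 * ℓ) by omega,
      show ¬ (2 * (ℓ + 1) = 2 * ℓ + 1) by omega]

lemma exists_isAvoidingPath (hc : ∀ e ∈ F, c e ∉ e) {B : Finset V} {v : V}
    (hv : ∃ e ∈ F, v ∈ e) (N : ℕ)
    (hext : ∀ ℓ ≤ N, ∀ m, IsAvoidingPath F c B v ℓ m → (extenders F c B ℓ m).Nonempty) :
    ∀ ℓ ≤ N, ∃ m, IsAvoidingPath F c B v ℓ m
  | 0, _ => ⟨fun _ => v, ⟨⟨by simp, fun i hi j hj _ => by simp at hi hj; omega⟩, rfl,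
      fun i h1 h2 => by omega, hv⟩⟩
  | ℓ + 1, h => by
    obtain ⟨m, hm⟩ := exists_isAvoidingPath hc hv N hext ℓ (by omega)
    obtain ⟨w, hw⟩ := hext ℓ (by omega) m hm
    exact ⟨_, hm.append hc hw⟩

/-- The colours that occur more than `h` times at `v`. -/
def heavyColors (G : Finset (Finset V)) (c : Finset V → V) (h : ℕ) (v : V) : Finset V :=
  univ.filter fun z => h < ((nbrs G v).filter fun w => c {v, w} = z).card

lemma card_heavyColors_mul_le (G : Finset (Finset V)) (c : Finset V → V) (h : ℕ) (v : V) :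
    (heavyColors G c h v).card * (h + 1) ≤ (nbrs G v).card := by
  rw [card_eq_sum_card_fiberwise (s := nbrs G v) (f := fun w => c {v, w}) (t := univ) (by simp)]
  calc (heavyColors G c h v).card * (h + 1)
      ≤ ∑ z ∈ heavyColors G c h v, ((nbrs G v).filter fun w => c {v, w} = z).card := by
        rw [← smul_eq_mul]
        exact card_nsmul_le_sum _ _ _ fun z hz => (mem_filter.1 hz).2
    _ ≤ _ := sum_le_sum_of_subset (subset_univ _)

/-- If no vertex closes the path to a rainbow cycle, then few vertices extend it by an edge whose
colour differs from the closing colour. -/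
lemma card_extenders_le_of_free (hXY : Disjoint X Y)
    (hG : ∀ e, e ∈ G ↔ ∃ x ∈ X, ∃ y ∈ Y, e = {x, y}) (hc : ∀ e ∈ G, c e ∉ e) (hFG : F ⊆ G) {p h : ℕ}
    (hp : 2 ≤ p) {v : V} {m : ℕ → V}
    (hm : IsAvoidingPath F c (heavyColors G c h v) v (2 * p - 2) m)
    (hfree : ∀ m, ¬ IsRainbowCycle G c (2 * p) m) :
    (extenders F c (heavyColors G c h v) (2 * p - 2) m).card ≤
      ((extenders F c (heavyColors G c h v) (2 * p - 2) m).filter fun w =>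
        c {m (2 * (2 * p - 2)), w} = c {v, w} ∧ w ∈ nbrs G v).card + 4 * p * h := by
  set B := heavyColors G c h v
  set W := extenders F c B (2 * p - 2) m with hWdef
  -- The edge `{v, w}` does not close a rainbow cycle, so its colour is on the path. It is either
  -- the colour of the last edge or one of the earlier `m i`; the latter avoid `B`, so each occurs
  -- at most `h` times at `v`.
  have hsub : W ⊆ (W.filter fun w => c {m (2 * (2 * p - 2)), w} = c {v, w} ∧ w ∈ nbrs G v) ∪
      (Finset.Icc 1 (4 * p - 4)).biUnion fun i => (nbrs G v).filter fun w => c {v, w} = m i := by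
    intro w hw
    have hm' := hm.append (fun e he => hc e (hFG he)) hw
    obtain ⟨⟨h1, h2⟩, h3, h4, -⟩ := hm'
    have hend : append c (2 * p - 2) m w (2 * (2 * p - 2 + 1)) = w := by
      simp [append, show ¬ (2 * (2 * p - 2 + 1) ≤ 2 * (2 * p - 2)) by omega,
        show ¬ (2 * (2 * p - 2 + 1) = 2 * (2 * p - 2) + 1) by omega]
    have hedge : {v, w} ∈ G := by
      have := pair_mem_of_odd hXY hG (fun i => append c (2 * p - 2) m w (2 * i)) (p - 1)
        (fun i hi => hFG (h1 i (by omega)).1)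
      simp only [mul_zero] at this
      rw [h3, show 2 * (2 * (p - 1) + 1) = 2 * (2 * p - 2 + 1) by omega, hend] at this
      exact this
    have hclose : ∃ i ≤ 2 * (2 * p - 2 + 1), c {v, w} = append c (2 * p - 2) m w i := by
      by_contra! hcon
      obtain ⟨m', hm'⟩ := IsRainbowPath.close (ℓ := 2 * p - 2 + 1) ⟨h1, h2⟩ hFG
        (by rw [hend, h3, pair_comm]; exact hedge)
        (by rw [hend, h3, pair_comm]; exact hcon)
      rw [show 2 * p - 2 + 1 + 1 = 2 * p by omega] at hm'
      exact hfree m' hm'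
    obtain ⟨i, hi, hci⟩ := hclose
    have hi0 : i ≠ 0 := by
      rintro rfl
      rw [h3] at hci
      exact hc _ hedge (by rw [hci]; simp)
    have hilast : i ≠ 2 * (2 * p - 2 + 1) := by
      rintro rfl
      rw [hend] at hci
      exact hc _ hedge (by rw [hci]; simp)
    rw [mem_union]
    by_cases hi2 : i = 2 * (2 * p - 2) + 1
    · left
      refine mem_filter.2 ⟨hw, ?_, mem_nbrs.2 hedge⟩
      rw [hci, hi2]
      simp [append]
    · right
      refine mem_biUnion.2 ⟨i, Finset.mem_Icc.2 ⟨by omega, by omega⟩,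
        mem_filter.2 ⟨mem_nbrs.2 hedge, ?_⟩⟩
      rw [hci]
      simp [append, show i ≤ 2 * (2 * p - 2) by omega]
  refine (card_le_card hsub).trans ((card_union_le _ _).trans (Nat.add_le_add_left ?_ _))
  refine (card_biUnion_le_card_mul _ _ h fun i hi => ?_).trans
    (Nat.mul_le_mul_right _ (by simp))
  rw [Finset.mem_Icc] at hi
  have := hm.2.2.1 i hi.1 (by omega)
  simpa [B, heavyColors] using this

/-- A graph of large minimum degree all of whose edges have small colour degree forces a rainbow
cycle in the ambient complete bipartite graph. -/
lemma exists_isRainbowCycle_of_thin (hXY : Disjoint X Y)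
    (hG : ∀ e, e ∈ G ↔ ∃ x ∈ X, ∃ y ∈ Y, e = {x, y}) (hc : ∀ e ∈ G, c e ∉ e) (hFG : F ⊆ G)
    {p s d Q : ℕ} (hp : 2 ≤ p) (hX : X.card = s) (hY : Y.card = s)
    (hthin : ∀ e ∈ F, ∀ u ∈ e, colorDegree G c u (c e) ≤ d) (hne : F.Nonempty)
    (hdeg : ∀ u, ∀ e ∈ F, u ∈ e → Q ≤ (F.filter (fun e => u ∈ e)).card)
    (hQ0 : 0 < Q) (hQ : 128 * p * d * s ≤ Q ^ 2) : ∃ m, IsRainbowCycle G c (2 * p) m := by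
  by_contra! hfree
  obtain ⟨e0, he0⟩ := hne
  obtain ⟨v, y, hve0, rfl⟩ : ∃ v y, v ∈ e0 ∧ e0 = {v, y} := by
    obtain ⟨x, -, y, -, rfl⟩ := (hG e0).1 (hFG he0)
    exact ⟨x, y, by simp, rfl⟩
  have hd : 1 ≤ d := by
    refine le_trans ?_ (hthin _ he0 v hve0)
    exact card_pos.2 ⟨_, mem_filter.2 ⟨hFG he0, hve0, rfl⟩⟩
  have hQs : Q ≤ s := (hdeg v _ he0 hve0).trans ((degree_le_card_nbrs hG hFG v).trans
    ((card_le_card fun w hw => mem_nbrs.2 (hFG (mem_nbrs.1 hw))).trans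
      (card_nbrs_le hXY hG hX hY v)))
  -- This choice makes the `4 * p * h` ends lost to colours that are not heavy at most `Q / 4`,
  -- while there are at most `16 * p * s / Q` heavy colours to avoid.
  set h := Q / (16 * p) with hh
  set B := heavyColors G c h v with hBdef
  have hB : B.card * (h + 1) ≤ s :=
    (card_heavyColors_mul_le G c h v).trans (card_nbrs_le hXY hG hX hY v)
  have hQh : Q < 16 * p * (h + 1) := Nat.lt_mul_div_succ _ (by omega)
  have hQh' : 16 * p * h ≤ Q := Nat.mul_div_le _ _
  have hBQ : B.card * Q ≤ 16 * p * s :=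
    calc B.card * Q ≤ B.card * (16 * p * (h + 1)) := Nat.mul_le_mul_left _ hQh.le
      _ = 16 * p * (B.card * (h + 1)) := by ring
      _ ≤ _ := Nat.mul_le_mul_left _ hB
  have hloss : 2 * ((d + 1) * (B.card + 4 * p)) ≤ Q := by
    refine Nat.le_of_mul_le_mul_right ?_ hQ0
    have h1 : 2 * ((d + 1) * (B.card + 4 * p)) * Q ≤ 4 * d * (B.card * Q + 4 * p * Q) := by
      have : 2 * (d + 1) ≤ 4 * d := by omega
      calc _ = 2 * (d + 1) * (B.card * Q + 4 * p * Q) := by ring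
        _ ≤ _ := Nat.mul_le_mul_right _ this
    have h2 : 4 * d * (B.card * Q + 4 * p * Q) ≤ 4 * d * (16 * p * s + 4 * p * s) :=
      Nat.mul_le_mul_left _ (add_le_add hBQ (Nat.mul_le_mul_left _ hQs))
    have h3 : 4 * d * (16 * p * s + 4 * p * s) = 80 * (p * d * s) := by ring
    have h4 : 128 * p * d * s = 128 * (p * d * s) := by ring
    have h5 : Q ^ 2 = Q * Q := by ring
    omega
  have hcF : ∀ e ∈ F, c e ∉ e := fun e he => hc e (hFG he)
  have hW : ∀ ℓ ≤ 2 * p - 2, ∀ m, IsAvoidingPath F c B v ℓ m →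
      Q ≤ 2 * (extenders F c B ℓ m).card := by
    intro ℓ hℓ m hm
    obtain ⟨e, he, hme⟩ := hm.2.2.2
    have h1 := (hdeg _ e he hme).trans ((degree_le_card_nbrs hG hFG _).trans
      (card_nbrs_le_card_extenders hFG hthin B ℓ m))
    have h2 : (d + 1) * (B.card + (2 * ℓ + 1)) ≤ (d + 1) * (B.card + 4 * p) :=
      Nat.mul_le_mul_left _ (by omega)
    omega
  obtain ⟨m, hm⟩ := exists_isAvoidingPath hcF ⟨_, he0, hve0⟩ (2 * p - 2)
    (fun ℓ hℓ m hm => card_pos.1 (by have := hW ℓ hℓ m hm; omega)) (2 * p - 3) (by omega)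
  set U := extenders F c B (2 * p - 3) m with hU
  have hUQ : Q ≤ 2 * U.card := hW _ (by omega) m hm
  -- With the path fixed up to its last two vertices `u, w`, the set `A u` holds the ends `w` for
  -- which `{u, w}` and `{v, w}` share a colour. At least `Q / 4` ends remain for each of at least
  -- `Q / 2` vertices `u`.
  let A : V → Finset V := fun u =>
    (extenders F c B (2 * p - 2) (append c (2 * p - 3) m u)).filter fun w =>
      c {u, w} = c {v, w} ∧ w ∈ nbrs G v
  have hlast : ∀ u, append c (2 * p - 3) m u (2 * (2 * p - 2)) = u := by
    intro u
    simp [append, show ¬ (2 * (2 * p - 2) ≤ 2 * (2 * p - 3)) by omega,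
      show ¬ (2 * (2 * p - 2) = 2 * (2 * p - 3) + 1) by omega]
  have hA : ∀ u ∈ U, Q ≤ 4 * (A u).card := by
    intro u hu
    have hm' := hm.append hcF hu
    rw [show 2 * p - 3 + 1 = 2 * p - 2 by omega] at hm'
    have h1 := hW _ le_rfl _ hm'
    have h2 := card_extenders_le_of_free hXY hG hc hFG hp hm' hfree
    rw [hlast] at h2
    have h3 : 4 * (4 * p * h) = 16 * p * h := by ring
    have h4 : (extenders F c B (2 * p - 2) (append c (2 * p - 3) m u)).card ≤
      (A u).card + 4 * p * h := h2
    omega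
  -- Double counting from `w`: the colour of `{v, w}` is prescribed, so thinness at `w` leaves at
  -- most `d` vertices `u`. Thus `Q ^ 2 ≤ 8 * s * d`, contradicting `hQ`.
  have hcount : ∑ u ∈ U, (A u).card ≤ s * d := by
    have h1 : ∀ u ∈ U, A u = bipartiteAbove (fun u w => w ∈ A u) (nbrs G v) u := by
      intro u _
      ext w
      simp only [bipartiteAbove, mem_filter]
      refine ⟨fun hw => ⟨(mem_filter.1 hw).2.2, hw⟩, fun hw => hw.2⟩
    rw [sum_congr rfl fun u hu => congrArg card (h1 u hu),
      sum_card_bipartiteAbove_eq_sum_card_bipartiteBelow]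
    refine (sum_le_card_nsmul _ _ d fun w _ => ?_).trans ?_
    · refine (card_le_card ?_).trans (card_nbrs_filter_le_of_thin hFG hthin w (c {v, w}))
      intro u hu
      obtain ⟨-, huA⟩ := mem_filter.1 hu
      obtain ⟨h2, h3, -⟩ := mem_filter.1 huA
      have h4 := mem_nbrs.1 (mem_filter.1 h2).1
      rw [hlast] at h4
      refine mem_filter.2 ⟨mem_nbrs.2 (by rwa [pair_comm]), by rw [pair_comm]; exact h3⟩
    · rw [smul_eq_mul]
      exact Nat.mul_le_mul_right _ (card_nbrs_le hXY hG hX hY v)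
  have hlow : U.card * Q ≤ 4 * ∑ u ∈ U, (A u).card := by
    rw [mul_sum, ← smul_eq_mul]
    exact card_nsmul_le_sum _ _ _ hA
  have h1 : Q * Q ≤ 2 * (U.card * Q) := by
    rw [← mul_assoc]; exact Nat.mul_le_mul_right _ hUQ
  have h2 : 128 * p * d * s = 128 * p * (s * d) := by ring
  have h3 : 256 * (s * d) ≤ 128 * p * (s * d) := Nat.mul_le_mul_right _ (by omega)
  have h4 : 0 < s * d := Nat.mul_pos (by omega) hd
  rw [pow_two] at hQ
  omega

/-- The edges of small colour degree at both ends are few. -/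
lemma card_thin_sq_le (hXY : Disjoint X Y)
    (hG : ∀ e, e ∈ G ↔ ∃ x ∈ X, ∃ y ∈ Y, e = {x, y}) (hc : ∀ e ∈ G, c e ∉ e)
    {p s : ℕ} (d : ℕ) (hp : 2 ≤ p) (hX : X.card = s) (hY : Y.card = s)
    (hfree : ¬ ContainsCycle (2 * p) (G.image fun e => insert (c e) e)) :
    (G.filter fun e => ∀ u ∈ e, colorDegree G c u (c e) ≤ d).card ^ 2 ≤ 512 * p * d * s ^ 3 := by
  set T := G.filter fun e => ∀ u ∈ e, colorDegree G c u (c e) ≤ d with hT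
  set q := Nat.sqrt (128 * p * d * s) with hq
  have hq1 : q * q ≤ 128 * p * d * s := Nat.sqrt_le _
  have hq2 : 128 * p * d * s < (q + 1) * (q + 1) := Nat.lt_succ_sqrt _
  have hXYs : (X ∪ Y).card ≤ 2 * s := (card_union_le _ _).trans (by omega)
  have hle : T.card ≤ q * (2 * s) := by
    by_contra! hlt
    obtain ⟨F, hFT, hne, hdeg⟩ := exists_subset_degree (fun (e : Finset V) (u : V) => u ∈ e) q _
      T (X ∪ Y) rfl ((Nat.mul_le_mul_left _ hXYs).trans_lt hlt)
    have hFG : F ⊆ G := hFT.trans (filter_subset _ _)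
    obtain ⟨m, hm⟩ := exists_isRainbowCycle_of_thin hXY hG hc hFG hp hX hY
      (fun e he => (mem_filter.1 (hFT he)).2) hne
      (fun u e he hu => hdeg u (by
        obtain ⟨x, hx, y, hy, rfl⟩ := (hG e).1 (hFG he)
        rw [mem_insert, mem_singleton] at hu
        rcases hu with rfl | rfl
        · exact mem_union_left _ hx
        · exact mem_union_right _ hy) e he hu)
      (Nat.succ_pos q) (by rw [pow_two]; exact hq2.le)
    exact hfree (hm.containsCycle (by omega))
  calc T.card ^ 2 ≤ (q * (2 * s)) ^ 2 := Nat.pow_le_pow_left hle 2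
    _ = q * q * (4 * s ^ 2) := by ring
    _ ≤ 128 * p * d * s * (4 * s ^ 2) := Nat.mul_le_mul_right _ hq1
    _ = _ := by ring

end Thin

/-! ### Counting colourings by product weights. -/

/-- If each member of a family of functions has weight at least `b` with respect to a product
weight of total mass at most `A ^ |ι|`, then the family has at most `A ^ |ι| / b` members. -/
lemma card_mul_le_of_weight {ι κ : Type*} [Fintype ι] [DecidableEq ι] (Z : Finset κ)
    (w : ι → κ → ℝ) (hw : ∀ i z, 0 ≤ w i z) {A b : ℝ} (hA : ∀ i, ∑ z ∈ Z, w i z ≤ A)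
    (S : Finset (ι → κ)) (hS : ∀ χ ∈ S, ∀ i, χ i ∈ Z) (hb : ∀ χ ∈ S, b ≤ ∏ i, w i (χ i)) :
    S.card * b ≤ A ^ Fintype.card ι := by
  calc (S.card : ℝ) * b ≤ ∑ χ ∈ S, ∏ i, w i (χ i) := by
        rw [← nsmul_eq_mul]; exact card_nsmul_le_sum _ _ _ hb
    _ ≤ ∑ χ ∈ Fintype.piFinset fun _ => Z, ∏ i, w i (χ i) :=
        sum_le_sum_of_subset_of_nonneg (fun χ hχ => Fintype.mem_piFinset.2 (hS χ hχ))
          fun χ _ _ => prod_nonneg fun i _ => hw i _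
    _ = ∏ i, ∑ z ∈ Z, w i z := (prod_univ_sum _ _).symm
    _ ≤ ∏ _i : ι, A := prod_le_prod (fun i _ => sum_nonneg fun z _ => hw i z) fun i _ => hA i
    _ = _ := by simp

/-- The number of functions to `ℕ` with sum at most `s`. -/
lemma card_sum_le (ι : Type*) [Fintype ι] [DecidableEq ι] (s : ℕ) (S : Finset (ι → ℕ))
    (hS : ∀ δ ∈ S, ∑ i, δ i ≤ s) : S.card ≤ 2 ^ (s + Fintype.card ι) := by
  have h := card_mul_le_of_weight (ι := ι) (range (s + 1)) (fun _ i => ((1 : ℝ) / 2) ^ i)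
    (fun _ _ => by positivity) (A := 2) (b := (1 / 2 : ℝ) ^ s) (fun _ => sum_geometric_two_le _) S
    (fun δ hδ i => mem_range.2 (Nat.lt_succ_of_le
      ((single_le_sum (fun _ _ => Nat.zero_le _) (mem_univ i)).trans (hS δ hδ))))
    (fun δ hδ => by
      rw [prod_pow_eq_pow_sum]
      exact pow_le_pow_of_le_one (by norm_num) (by norm_num) (hS δ hδ))
  rw [one_div, inv_pow, ← div_eq_mul_inv, div_le_iff₀ (by positivity), ← pow_add, add_comm] at h
  exact_mod_cast h

section Weight
variable {V : Type*} [DecidableEq V] {G : Finset (Finset V)} {c : Finset V → V} {X Y : Finset V}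

lemma sum_colorDegree_le (G : Finset (Finset V)) (c : Finset V → V) (u : V) (Z : Finset V) :
    ∑ z ∈ Z, colorDegree G c u z ≤ (G.filter fun e => u ∈ e).card := by
  have h : ∀ z, colorDegree G c u z = ((G.filter fun e => u ∈ e).filter fun e => c e = z).card :=
    fun z => by rw [colorDegree, filter_filter]
  simp only [h]
  rw [← card_biUnion]
  · exact card_le_card (biUnion_subset.2 fun z _ => filter_subset _ _)
  · intro z _ z' _ hzz
    rw [Function.onFun, disjoint_left]
    intro e he he'
    exact hzz ((mem_filter.1 he).2.symm.trans (mem_filter.1 he').2)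

lemma card_edges_le (hG : ∀ e, e ∈ G ↔ ∃ x ∈ X, ∃ y ∈ Y, e = {x, y}) {s : ℕ} (hX : X.card = s)
    (hY : Y.card = s) : G.card ≤ s ^ 2 := by
  calc G.card ≤ ((X ×ˢ Y).image fun z => ({z.1, z.2} : Finset V)).card := card_le_card fun e he => by
        obtain ⟨x, hx, y, hy, rfl⟩ := (hG e).1 he
        exact mem_image.2 ⟨(x, y), mem_product.2 ⟨hx, hy⟩, rfl⟩
    _ ≤ _ := card_image_le
    _ = s ^ 2 := by rw [card_product, hX, hY, pow_two]

variable [Fintype V]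

/-- The logarithmic deficiencies of the colour degrees have bounded average. -/
lemma sum_log_le (hXY : Disjoint X Y)
    (hG : ∀ e, e ∈ G ↔ ∃ x ∈ X, ∃ y ∈ Y, e = {x, y}) (hc : ∀ e ∈ G, c e ∉ e)
    {p s : ℕ} (hp : 2 ≤ p) (hX : X.card = s) (hY : Y.card = s)
    (hfree : ¬ ContainsCycle (2 * p) (G.image fun e => insert (c e) e)) :
    ∑ e ∈ G, Nat.log 4 (s / e.sup fun u => colorDegree G c u (c e)) ≤ 1024 * p * s ^ 2 := by
  set D : Finset V → ℕ := fun e => e.sup fun u => colorDegree G c u (c e) with hD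
  -- Each logarithm is written as the number of levels below it. Base `4` is chosen because the
  -- square root in the thin-edge bound turns `4 ^ j` into `2 ^ j`, leaving a geometric series over
  -- the levels.
  have hlog : ∀ e, Nat.log 4 (s / D e) =
      ((range s).filter fun j => j < Nat.log 4 (s / D e)).card := by
    intro e
    have h1 : Nat.log 4 (s / D e) ≤ s := (Nat.log_le_self _ _).trans (Nat.div_le_self _ _)
    rw [show ((range s).filter fun j => j < Nat.log 4 (s / D e)) = range (Nat.log 4 (s / D e)) by
      ext j; simp; omega, card_range]
  have hlevel : ∀ j ∈ range s, (G.filter fun e => j < Nat.log 4 (s / D e)).card ≤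
      512 * p * s ^ 2 / 2 ^ j := by
    intro j _
    rw [Nat.le_div_iff_mul_le (by positivity)]
    have hsub : (G.filter fun e => j < Nat.log 4 (s / D e)) ⊆
        G.filter fun e => ∀ u ∈ e, colorDegree G c u (c e) ≤ s / 4 ^ j := by
      intro e he
      obtain ⟨he, hj⟩ := mem_filter.1 he
      refine mem_filter.2 ⟨he, fun u hu => (le_sup (f := fun u => colorDegree G c u (c e)) hu).trans
        ?_⟩
      have h0 : s / D e ≠ 0 := by rintro h; rw [h] at hj; simp at hj
      have h1 : 4 ^ j ≤ s / D e := (Nat.pow_le_pow_right (by norm_num) hj.le).trans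
        (Nat.pow_log_le_self 4 h0)
      have hD0 : 0 < D e := by
        rcases Nat.eq_zero_or_pos (D e) with h | h
        · rw [h] at h0; simp at h0
        · exact h
      rw [Nat.le_div_iff_mul_le hD0] at h1
      rw [Nat.le_div_iff_mul_le (by positivity), mul_comm]
      exact h1
    have hthin := card_thin_sq_le hXY hG hc (s / 4 ^ j) hp hX hY hfree
    refine (Nat.pow_le_pow_iff_left two_ne_zero).1 ?_
    calc _ ≤ ((G.filter fun e => ∀ u ∈ e, colorDegree G c u (c e) ≤ s / 4 ^ j).card * 2 ^ j) ^ 2 :=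
          Nat.pow_le_pow_left (Nat.mul_le_mul_right _ (card_le_card hsub)) 2
      _ = _ ^ 2 * 4 ^ j := by rw [mul_pow, ← pow_mul, mul_comm j 2, pow_mul]; norm_num
      _ ≤ 512 * p * (s / 4 ^ j) * s ^ 3 * 4 ^ j := Nat.mul_le_mul_right _ hthin
      _ = 512 * p * s ^ 3 * (s / 4 ^ j * 4 ^ j) := by ring
      _ ≤ 512 * p * s ^ 3 * s := Nat.mul_le_mul_left _ (Nat.div_mul_le_self _ _)
      _ = 512 * p * (s ^ 2) ^ 2 := by ring
      _ ≤ (512 * p) ^ 2 * (s ^ 2) ^ 2 :=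
          Nat.mul_le_mul_right _ (Nat.le_self_pow (by norm_num) _)
      _ = _ := by ring
  rw [sum_congr rfl fun e _ => hlog e]
  have hswap := sum_card_bipartiteAbove_eq_sum_card_bipartiteBelow (s := G) (t := range s)
    (fun e j => j < Nat.log 4 (s / D e))
  simp only [bipartiteAbove, bipartiteBelow] at hswap
  rw [hswap]
  refine (sum_le_sum hlevel).trans ((Nat.geom_sum_le le_rfl _ _).trans ?_)
  simp only [Nat.add_one_sub_one, Nat.div_one]
  ring_nf
  exact le_rfl

/-- A colouring with `C_{2p}`-free extension has large weight in the product measure built from its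
own colour degrees. -/
lemma le_prod_colorDegree (hXY : Disjoint X Y)
    (hG : ∀ e, e ∈ G ↔ ∃ x ∈ X, ∃ y ∈ Y, e = {x, y}) (hc : ∀ e ∈ G, c e ∉ e)
    {p s : ℕ} (hp : 2 ≤ p) (hs : 1 ≤ s) (hX : X.card = s) (hY : Y.card = s)
    (hfree : ¬ ContainsCycle (2 * p) (G.image fun e => insert (c e) e)) :
    (((8 : ℝ) * 4 ^ (1024 * p)) ^ s ^ 2)⁻¹ ≤
      ∏ e ∈ G, (∑ u ∈ e, (colorDegree G c u (c e) : ℝ)) / (2 * s) := by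
  set D : Finset V → ℕ := fun e => e.sup fun u => colorDegree G c u (c e) with hD
  have hstep : ∀ e ∈ G, ((8 : ℝ) * 4 ^ Nat.log 4 (s / D e))⁻¹ ≤
      (∑ u ∈ e, (colorDegree G c u (c e) : ℝ)) / (2 * s) := by
    intro e he
    have hne : e.Nonempty := by
      obtain ⟨x, -, y, -, rfl⟩ := (hG e).1 he
      exact ⟨x, by simp⟩
    obtain ⟨u, hu, huD⟩ := exists_mem_eq_sup e hne fun u => colorDegree G c u (c e)
    have hDsum : (D e : ℝ) ≤ ∑ u ∈ e, (colorDegree G c u (c e) : ℝ) := by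
      rw [hD]
      simp only [huD]
      exact single_le_sum (f := fun u => (colorDegree G c u (c e) : ℝ))
        (fun _ _ => Nat.cast_nonneg _) hu
    have hDpos : 0 < D e := by
      rw [hD]
      simp only [huD]
      exact card_pos.2 ⟨e, mem_filter.2 ⟨he, hu, rfl⟩⟩
    -- Rounding the logarithm down costs a factor `4`; with the `2` from the denominator `2 * s`
    -- this gives the constant `8`.
    have h1 : s < D e * 4 ^ (Nat.log 4 (s / D e) + 1) := by
      have h2 := Nat.lt_pow_succ_log_self (b := 4) (by norm_num) (s / D e)
      rw [Nat.div_lt_iff_lt_mul hDpos, mul_comm] at h2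
      exact h2
    have h2 : (s : ℝ) ≤ D e * (4 ^ Nat.log 4 (s / D e) * 4) := by
      rw [← pow_succ]; exact_mod_cast h1.le
    refine le_trans ?_ (div_le_div_of_nonneg_right hDsum (by positivity))
    have hs0 : (0 : ℝ) < s := by exact_mod_cast hs
    rw [inv_eq_one_div, div_le_div_iff₀ (by positivity) (by positivity)]
    linarith
  refine le_trans ?_ (prod_le_prod (fun e _ => by positivity) hstep)
  rw [prod_inv_distrib, prod_mul_distrib, prod_const, prod_pow_eq_pow_sum]
  refine inv_anti₀ (by positivity) ?_
  rw [mul_pow, ← pow_mul]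
  exact mul_le_mul (pow_le_pow_right₀ (by norm_num) (card_edges_le hG hX hY))
    (pow_le_pow_right₀ (by norm_num) (sum_log_le hXY hG hc hp hX hY hfree)) (by positivity)
    (by positivity)

/-- The number of colourings of `K_{s,s}` with `C_{2p}`-free extension and a given palette. -/
lemma card_colorings_le [Nonempty V] (hXY : Disjoint X Y)
    (hG : ∀ e, e ∈ G ↔ ∃ x ∈ X, ∃ y ∈ Y, e = {x, y})
    {p s : ℕ} (hp : 2 ≤ p) (hs : 1 ≤ s) (hX : X.card = s) (hY : Y.card = s) (Z : Finset V) :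
    Nat.card {χ : {e // e ∈ G} → V // (∀ e, χ e ∈ Z) ∧ IsColoring G χ ∧
      ¬ ContainsCycle (2 * p) (extension G χ)} ≤
      (2 ^ (s + Z.card)) ^ (2 * s) * (8 * 4 ^ (1024 * p)) ^ s ^ 2 := by
  classical
  rw [Nat.card_eq_fintype_card, Fintype.card_subtype]
  set S := univ.filter fun χ : {e // e ∈ G} → V => (∀ e, χ e ∈ Z) ∧ IsColoring G χ ∧
      ¬ ContainsCycle (2 * p) (extension G χ) with hS
  choose c hc using fun χ : {e // e ∈ G} → V => exists_total χ
  have hdeg : ∀ u, (G.filter fun e => u ∈ e).card ≤ s := fun u =>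
    (degree_le_card_nbrs hG Subset.rfl u).trans (card_nbrs_le hXY hG hX hY u)
  have hWs : (X ∪ Y).card ≤ 2 * s := (card_union_le _ _).trans (by omega)
  have hW : ∀ e ∈ G, e ⊆ X ∪ Y := by
    intro e he
    obtain ⟨x, hx, y, hy, rfl⟩ := (hG e).1 he
    intro z
    simp only [mem_insert, mem_singleton, mem_union]
    rintro (rfl | rfl)
    · exact Or.inl hx
    · exact Or.inr hy
  let T : ({e // e ∈ G} → V) → {u // u ∈ X ∪ Y} → {z // z ∈ Z} → ℕ :=
    fun χ u z => colorDegree G (c χ) u z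
  have hTimage : (S.image T).card ≤ (2 ^ (s + Z.card)) ^ (2 * s) := by
    have hsub : S.image T ⊆ Fintype.piFinset fun u : {u // u ∈ X ∪ Y} =>
        (S.image T).image fun δ => δ u := by
      intro δ hδ
      exact Fintype.mem_piFinset.2 fun u => mem_image_of_mem _ hδ
    refine (card_le_card hsub).trans ?_
    rw [Fintype.card_piFinset]
    refine (prod_le_pow_card _ _ (2 ^ (s + Z.card)) fun u _ => ?_).trans ?_
    · have := card_sum_le {z // z ∈ Z} s ((S.image T).image fun δ => δ u) (fun δ hδ => by
        obtain ⟨δ', hδ', rfl⟩ := mem_image.1 hδ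
        obtain ⟨χ, -, rfl⟩ := mem_image.1 hδ'
        refine le_trans (le_of_eq ?_) ((sum_colorDegree_le G (c χ) u Z).trans (hdeg u))
        exact sum_coe_sort Z fun z => colorDegree G (c χ) u z)
      rwa [Fintype.card_coe] at this
    · rw [card_univ, Fintype.card_coe]
      exact Nat.pow_le_pow_right (by positivity) hWs
  refine (card_le_mul_card_image (f := T) S ((8 * 4 ^ (1024 * p)) ^ s ^ 2) ?_).trans
    (by rw [mul_comm]; exact Nat.mul_le_mul_right _ hTimage)
  intro δ hδ
  obtain ⟨χ₀, -, rfl⟩ := mem_image.1 hδ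
  have hs0 : (0 : ℝ) < s := by exact_mod_cast hs
  -- The weights come from the table of `χ₀`, shared by all colourings in the fibre. At each of the
  -- two ends the colour degrees sum to at most `s`, so dividing by `2 * s` gives mass at most `1`
  -- per edge.
  have h := card_mul_le_of_weight (ι := {e // e ∈ G}) Z
    (fun e z => (∑ u ∈ e.1, (colorDegree G (c χ₀) u z : ℝ)) / (2 * s))
    (fun e z => by positivity) (A := 1) (b := (((8 : ℝ) * 4 ^ (1024 * p)) ^ s ^ 2)⁻¹)
    (fun e => by
      rw [← sum_div, div_le_one (by positivity), sum_comm]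
      have h1 : ∀ u ∈ e.1, ∑ z ∈ Z, (colorDegree G (c χ₀) u z : ℝ) ≤ s := fun u _ => by
        exact_mod_cast (sum_colorDegree_le G (c χ₀) u Z).trans (hdeg u)
      have h2 : e.1.card ≤ 2 := by
        obtain ⟨x, -, y, -, h⟩ := (hG e.1).1 e.2
        rw [h]; exact card_le_two
      refine (sum_le_card_nsmul _ _ _ h1).trans ?_
      rw [nsmul_eq_mul]
      exact mul_le_mul_of_nonneg_right (by exact_mod_cast h2) hs0.le)
    (S.filter fun χ => T χ = T χ₀)
    (fun χ hχ => (mem_filter.1 (mem_filter.1 hχ).1).2.1)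
    (fun χ hχ => by
      obtain ⟨hχS, hT⟩ := mem_filter.1 hχ
      obtain ⟨hχZ, hcol, hfree⟩ := (mem_filter.1 hχS).2
      rw [extension_eq_image (hc χ)] at hfree
      refine (le_prod_colorDegree hXY hG (c := c χ)
        (fun e he => by rw [hc χ ⟨e, he⟩]; exact hcol ⟨e, he⟩) hp hs hX hY hfree).trans
        (le_of_eq ?_)
      rw [← prod_coe_sort]
      refine prod_congr rfl fun e _ => ?_
      congr 1
      refine sum_congr rfl fun u hu => ?_
      have := congrFun (congrFun hT ⟨u, hW e.1 e.2 hu⟩) ⟨χ e, hχZ e⟩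
      simp only [T] at this
      rw [hc χ e, this])
  rw [one_pow, ← div_eq_mul_inv, div_le_one (by positivity)] at h
  exact_mod_cast h

end Weight

/-! ### Assembly of the bound for even cycles. -/

lemma f_three_le (n p s : ℕ) (hp : 2 ≤ p) (hs : 1 ≤ s) (hn : 1 ≤ n) :
    f 3 n (2 * p) s ≤ n ^ ((2 + 2 * p) * s) *
      (2 ^ (2 + 4 * p) * (8 * 4 ^ (1024 * p))) ^ s ^ 2 := by
  have : Nonempty (Fin n) := ⟨⟨0, hn⟩⟩
  refine (f_le_mul 3 n (2 * p) s (n ^ (2 * p * s) * ((2 ^ (s + 2 * p * s)) ^ (2 * s) *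
    (8 * 4 ^ (1024 * p)) ^ s ^ 2)) fun G hbal => ?_).trans (le_of_eq ?_)
  · obtain ⟨P, hP, hcard, hGP⟩ := hbal
    have hXY : Disjoint (P 0) (P 1) := hP 0 1 (by decide)
    have hG : ∀ e, e ∈ G ↔ ∃ x ∈ P 0, ∃ y ∈ P 1, e = {x, y} := by
      intro e
      rw [mem_iff_exists_transversal hP hGP]
      have himg : ∀ g : Fin 2 → Fin n, univ.image g = {g 0, g 1} := fun g => by
        ext a; simp [Fin.exists_fin_two, eq_comm]
      constructor
      · rintro ⟨g, hg, rfl⟩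
        exact ⟨g 0, hg 0, g 1, hg 1, himg g⟩
      · rintro ⟨x, hx, y, hy, rfl⟩
        exact ⟨![x, y], fun i => by fin_cases i <;> assumption, himg _⟩
    have key := card_le_of_card_image_le
      (fun χ : {e // e ∈ G} → Fin n => IsColoring G χ ∧ ¬ ContainsCycle (2 * p) (extension G χ))
      (2 * p * s) ((2 ^ (s + 2 * p * s)) ^ (2 * s) * (8 * 4 ^ (1024 * p)) ^ s ^ 2)
      (fun χ hχ => by
        obtain ⟨c, hc⟩ := exists_total χ
        rw [image_eq_of_total hc]
        obtain ⟨hcol, hfree⟩ := hχ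
        rw [extension_eq_image hc] at hfree
        exact card_image_le_of_free hXY hG
          (fun e he => by rw [hc ⟨e, he⟩]; exact hcol ⟨e, he⟩) hp (hcard 0) (hcard 1) hfree)
      (fun Z hZ => (card_colorings_le hXY hG hp hs (hcard 0) (hcard 1) Z).trans
        (Nat.mul_le_mul_right _ (Nat.pow_le_pow_left
          (Nat.pow_le_pow_right (by norm_num) (by omega)) _)))
    rwa [Fintype.card_fin] at key
  · have h : (2 ^ (s + 2 * p * s)) ^ (2 * s) = (2 ^ (2 + 4 * p)) ^ s ^ 2 := by
      rw [← pow_mul, ← pow_mul]; congr 1; ring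
    rw [h, mul_pow (2 ^ (2 + 4 * p)), ← mul_assoc, ← pow_add]
    congr 2
    rw [show 3 - 1 = 2 by rfl]
    ring

theorem f_three_le_of_even (k : ℕ) (hk : 3 ≤ k) (heven : Even k) :
    ∃ D : ℝ, 0 < D ∧ ∀ n s : ℕ, 1 ≤ s →
      (f 3 n k s : ℝ) ≤
        (2 : ℝ) ^ ((5 / 2 : ℝ) * (k : ℝ) * (s : ℝ) * Real.logb 2 (n : ℝ)
          + 4 * (s : ℝ) ^ 2 * Real.logb 2 D) := by
  obtain ⟨p, hp⟩ := heven
  obtain rfl : k = 2 * p := by omega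
  set D : ℕ := 2 ^ (2 + 4 * p) * (8 * 4 ^ (1024 * p)) with hD
  have hD1 : 1 ≤ D := Nat.one_le_iff_ne_zero.2 (by positivity)
  refine ⟨(D : ℝ), by exact_mod_cast hD1, fun n s hs => ?_⟩
  rcases Nat.eq_zero_or_pos n with rfl | hn
  · rw [f_zero 3 (2 * p) s (by omega) hs]
    simp only [Nat.cast_zero]
    positivity
  have h := f_three_le n p s (by omega) hs hn
  -- Since `p ≥ 2`, `2 + 2 * p ≤ 5 * p`, and `5 * p` is `(5 / 2) * k`.
  have h2 : n ^ ((2 + 2 * p) * s) * D ^ s ^ 2 ≤ n ^ (5 * p * s) * D ^ (4 * s ^ 2) :=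
    Nat.mul_le_mul (Nat.pow_le_pow_right hn (Nat.mul_le_mul_right _ (by omega)))
      (Nat.pow_le_pow_right hD1 (by omega))
  refine (Nat.cast_le.2 (h.trans h2)).trans (le_of_eq ?_)
  rw [Real.rpow_add (by norm_num)]
  have e1 := rpow_logb_natCast hn (5 * p * s)
  have e2 := rpow_logb_natCast hD1 (4 * s ^ 2)
  push_cast at e1 e2 ⊢
  rw [← e1, ← e2]
  congr 3
  ring

end LooseCycle

theorem theorem2 :
    (∀ k : ℕ, 3 ≤ k → Even k → ∃ D : ℝ, 0 < D ∧ ∀ n s : ℕ, 1 ≤ s →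
      (LooseCycle.f 3 n k s : ℝ) ≤
        (2 : ℝ) ^ ((5 / 2 : ℝ) * (k : ℝ) * (s : ℝ) * Real.logb 2 (n : ℝ)
          + 4 * (s : ℝ) ^ 2 * Real.logb 2 D)) ∧
    (∀ r k : ℕ, 3 < r → 3 ≤ k → ∃ c₂ : ℝ, 0 < c₂ ∧ ∀ n s : ℕ, 1 ≤ s →
      (LooseCycle.f r n k s : ℝ) ≤
        (2 : ℝ) ^ ((c₂ + 2 * (r : ℝ)) * (s : ℝ) ^ (r - 2) * Real.logb 2 (n : ℝ)
          + (s : ℝ) ^ (r - 1) *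
            (Real.logb 2 (c₂ + (r : ℝ)) + ((r : ℝ) - 2) * Real.logb 2 (s : ℝ)))) :=
  ⟨LooseCycle.f_three_le_of_even, LooseCycle.f_le_of_uniformity_gt_three⟩
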